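/- All vector spaces are over $\mathbb{C}$. Let $C'(\mathbb{Z}_2)$ be the Hopf algebra with basis $1,g$, where $g^2=1$, $\Delta g=g\otimes g$, $\epsilon(g)=1$, $Sg=g$, with the coquasitriangular structure $\mathcal{R}(g^i\otimes g^k)=(-1)^{ik}$; write $C(\mathbb{Z}_2)$ for the same Hopf algebra regarded as a trivial left $C'(\mathbb{Z}_2)$-comodule. A surjection of coquasitriangular Hopf algebras is a surjective Hopf algebra homomorphism under which the coquasitriangular structure of the target pulls back to that of the source. A ($\mathbb{Z}_2$-graded) group extension $\sigma:B\twoheadrightarrow C(\mathbb{Z}_2)$ is a braided commutative Hopf algebra $B$ in the braided category of left $C'(\mathbb{Z}_2)$-comodules (that is, a $\mathbb{Z}_2$-graded commutative Hopf algebra, or supergroup) with a surjective homomorphism $\sigma$ of braided Hopf algebras. Let $B\rtimes C'(\mathbb{Z}_2)$ be the bosonization of $B$, with coquasitriangular structure $\mathcal{R}((b\otimes h)\otimes(c\otimes k))=\epsilon(b)\epsilon(c)\mathcal{R}(h\otimes k)$, and let $\tilde\sigma=\sigma\otimes\mathrm{id}:B\rtimes C'(\mathbb{Z}_2)\to C(\mathbb{Z}_2)\otimes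 C'(\mathbb{Z}_2)$. The spin-statistics reduction of $B\rtimes C'(\mathbb{Z}_2)$ is the largest subspace $W$ with $(\mathrm{id}\otimes\tilde\sigma\otimes\mathrm{id})\Delta^2(W)\subseteq W\otimes(D\cap\tau D)\otimes W$, where $D=\Delta(C'(\mathbb{Z}_2))$ and $\tau$ is the flip. Let $\pi:A\twoheadrightarrow C'(\mathbb{Z}_2)$ be a surjection of coquasitriangular Hopf algebras. A group extension $\sigma:B\twoheadrightarrow C(\mathbb{Z}_2)$ together with a map $j:A\to B\rtimes C'(\mathbb{Z}_2)$ is said to correspond to $\pi$ if $j$ is an isomorphism of coquasitriangular Hopf algebras from $A$ onto the spin-statistics reduction of $B\rtimes C'(\mathbb{Z}_2)$, if $\tilde\sigma\circ j=\Delta\circ\pi$, and if $A\otimes C'(\mathbb{Z}_2)\to B\rtimes C'(\mathbb{Z}_2)$, $a\otimes h\mapsto j(a)(1\otimes h)$, is bijective. **Proposition.** Let $\phi:A'\twoheadrightarrow A$ and $\pi:A\twoheadrightarrow C'(\mathbb{Z}_2)$ be surjections of coquasitriangular Hopf algebras. Then there are group extensions $(\sigma:B\twoheadrightarrow C(\mathbb{Z}_2),\,j)$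 corresponding to $\pi$ and $(\sigma':B'\twoheadrightarrow C(\mathbb{Z}_2),\,j')$ corresponding to $\pi\circ\phi$. For all such $(\sigma,j)$ and $(\sigma',j')$ there is exactly one homomorphism $\rho:B'\to B$ of $\mathbb{Z}_2$-graded Hopf algebras with $(\rho\otimes\mathrm{id})\circ j'=j\circ\phi$, and this $\rho$ is surjective and satisfies $\sigma\circ\rho=\sigma'$. Thus every quantum group extension $A'\twoheadrightarrow A$ over $C'(\mathbb{Z}_2)$ is induced, by restricting $\rho\otimes\mathrm{id}$ to the spin-statistics reductions, from a supergroup extension $B'\twoheadrightarrow B\twoheadrightarrow C(\mathbb{Z}_2)$. -/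

import Mathlib

open scoped TensorProduct

universe u v

noncomputable section

namespace QG

section General

variable {H : Type*} [Ring H] [HopfAlgebra ℂ H]

/-! ## Coquasitriangular Hopf algebras -/

/-- Convolution product of two linear functionals on a coalgebra. -/
def conv {C : Type*} [AddCommGroup C] [Module ℂ C] [Coalgebra ℂ C] (f g : C →ₗ[ℂ] ℂ) :
    C →ₗ[ℂ] ℂ :=
  LinearMap.mul' ℂ ℂ ∘ₗ TensorProduct.map f g ∘ₗ Coalgebra.comul

/-- `R : H ⊗ H → ℂ` (written as a bilinear form) is a coquasitriangular structure on the Hopf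
algebra `H`:
* `R(ab ⊗ c) = R(a ⊗ c₁) R(b ⊗ c₂)` and `R(a ⊗ bc) = R(a₁ ⊗ c) R(a₂ ⊗ b)`;
* `R(a₁ ⊗ b₁) a₂ b₂ = b₁ a₁ R(a₂ ⊗ b₂)`;
* `R` is invertible for the convolution product on functionals on `H ⊗ H`. -/
structure IsCoquasitriangular (R : H →ₗ[ℂ] H →ₗ[ℂ] ℂ) : Prop where
  mul_left : ∀ a b c : H,
    R (a * b) c = LinearMap.mul' ℂ ℂ (TensorProduct.map (R a) (R b) (Coalgebra.comul c))
  mul_right : ∀ a b c : H,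
    R a (b * c) =
      LinearMap.mul' ℂ ℂ (TensorProduct.map (R.flip c) (R.flip b) (Coalgebra.comul a))
  quasi_comm :
    (TensorProduct.lid ℂ H).toLinearMap ∘ₗ
        TensorProduct.map (TensorProduct.lift R) (LinearMap.mul' ℂ H) ∘ₗ
        (Coalgebra.comul : H ⊗[ℂ] H →ₗ[ℂ] (H ⊗[ℂ] H) ⊗[ℂ] (H ⊗[ℂ] H)) =
      (TensorProduct.rid ℂ H).toLinearMap ∘ₗ
        TensorProduct.map (LinearMap.mul' ℂ H ∘ₗ (TensorProduct.comm ℂ H H).toLinearMap)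
          (TensorProduct.lift R) ∘ₗ
        (Coalgebra.comul : H ⊗[ℂ] H →ₗ[ℂ] (H ⊗[ℂ] H) ⊗[ℂ] (H ⊗[ℂ] H))
  invertible : ∃ T : H ⊗[ℂ] H →ₗ[ℂ] ℂ,
    conv (TensorProduct.lift R) T = Coalgebra.counit ∧
    conv T (TensorProduct.lift R) = Coalgebra.counit

/-- `f : A → H` is a surjection of coquasitriangular Hopf algebras `(A, RA) ↠ (H, RH)`: a
surjective Hopf algebra homomorphism under which `RH` pulls back to `RA`. When `(A, RA)` is
coquasitriangular, this says that it is a solution of the quantum group extension problem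
for `(H, RH)`. -/
structure IsQuantumGroupSurjection {A : Type*} [Ring A] [HopfAlgebra ℂ A]
    (RA : A →ₗ[ℂ] A →ₗ[ℂ] ℂ) (RH : H →ₗ[ℂ] H →ₗ[ℂ] ℂ) (f : A →ₐc[ℂ] H) : Prop where
  surjective : Function.Surjective f
  pullback : ∀ a b : A, RH (f a) (f b) = RA a b

/-! ## Left comodules and the braiding -/

section Comodule

variable {V W X Y V' W' : Type*}
  [AddCommGroup V] [Module ℂ V] [AddCommGroup W] [Module ℂ W]
  [AddCommGroup X] [Module ℂ X] [AddCommGroup Y] [Module ℂ Y]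
  [AddCommGroup V'] [Module ℂ V'] [AddCommGroup W'] [Module ℂ W']

/-- `δ` is a left coaction of `H` on `V`, written `v ↦ v₍₁₎ ⊗ v₍₂₎`. -/
structure IsCoaction (δ : V →ₗ[ℂ] H ⊗[ℂ] V) : Prop where
  coassoc : (TensorProduct.assoc ℂ H H V).toLinearMap ∘ₗ
      LinearMap.rTensor V Coalgebra.comul ∘ₗ δ = LinearMap.lTensor H δ ∘ₗ δ
  counit : (TensorProduct.lid ℂ V).toLinearMap ∘ₗ
      LinearMap.rTensor V Coalgebra.counit ∘ₗ δ = LinearMap.id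

variable (H V) in
/-- The trivial coaction `v ↦ 1 ⊗ v`. -/
def trivialCoaction : V →ₗ[ℂ] H ⊗[ℂ] V := TensorProduct.mk ℂ H V 1

/-- The coaction `v ⊗ w ↦ v₍₁₎ w₍₁₎ ⊗ (v₍₂₎ ⊗ w₍₂₎)` on a tensor product of comodules. -/
def tensorCoaction (δV : V →ₗ[ℂ] H ⊗[ℂ] V) (δW : W →ₗ[ℂ] H ⊗[ℂ] W) :
    V ⊗[ℂ] W →ₗ[ℂ] H ⊗[ℂ] (V ⊗[ℂ] W) :=
  LinearMap.rTensor (V ⊗[ℂ] W) (LinearMap.mul' ℂ H) ∘ₗ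
    (TensorProduct.tensorTensorTensorComm ℂ H V H W).toLinearMap ∘ₗ TensorProduct.map δV δW

/-- The braiding `ψ(v ⊗ w) = R(w₍₁₎ ⊗ v₍₁₎) w₍₂₎ ⊗ v₍₂₎` of left `H`-comodules. -/
def braiding (R : H →ₗ[ℂ] H →ₗ[ℂ] ℂ) (δV : V →ₗ[ℂ] H ⊗[ℂ] V) (δW : W →ₗ[ℂ] H ⊗[ℂ] W) :
    V ⊗[ℂ] W →ₗ[ℂ] W ⊗[ℂ] V :=
  (TensorProduct.lid ℂ (W ⊗[ℂ] V)).toLinearMap ∘ₗ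
    TensorProduct.map (TensorProduct.lift R.flip) (TensorProduct.comm ℂ V W).toLinearMap ∘ₗ
    (TensorProduct.tensorTensorTensorComm ℂ H V H W).toLinearMap ∘ₗ TensorProduct.map δV δW

/-- `id ⊗ f ⊗ id`, applied to the two middle factors. -/
def mid (f : W ⊗[ℂ] X →ₗ[ℂ] V' ⊗[ℂ] W') :
    (V ⊗[ℂ] W) ⊗[ℂ] (X ⊗[ℂ] Y) →ₗ[ℂ] (V ⊗[ℂ] V') ⊗[ℂ] (W' ⊗[ℂ] Y) :=
  (TensorProduct.assoc ℂ V V' (W' ⊗[ℂ] Y)).symm.toLinearMap ∘ₗ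
    LinearMap.lTensor V ((TensorProduct.assoc ℂ V' W' Y).toLinearMap ∘ₗ
      LinearMap.rTensor Y f ∘ₗ (TensorProduct.assoc ℂ W X Y).symm.toLinearMap) ∘ₗ
    (TensorProduct.assoc ℂ V W (X ⊗[ℂ] Y)).toLinearMap

end Comodule

/-! ## Braided Hopf algebras in the category of left comodules -/

/-- A Hopf algebra in the braided category of left `H`-comodules, with the braiding given by `R`:
a comodule `B` with an algebra structure, a coalgebra structure and an antipode, all of whose
structure maps are comodule maps, satisfying the Hopf algebra axioms with the coproduct
multiplicative for the braided tensor product algebra `B ⊗ B`. -/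
structure BraidedHopfAlgebra (R : H →ₗ[ℂ] H →ₗ[ℂ] ℂ) (B : Type*) [Ring B] [Algebra ℂ B]
    [Coalgebra ℂ B] where
  coact : B →ₗ[ℂ] H ⊗[ℂ] B
  antipode : B →ₗ[ℂ] B
  isCoaction : IsCoaction coact
  coact_one : coact 1 = 1 ⊗ₜ 1
  coact_mul : coact ∘ₗ LinearMap.mul' ℂ B =
    LinearMap.lTensor H (LinearMap.mul' ℂ B) ∘ₗ tensorCoaction coact coact
  coact_counit : ∀ b : B, LinearMap.lTensor H Coalgebra.counit (coact b) =
    1 ⊗ₜ[ℂ] (Coalgebra.counit b : ℂ)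
  coact_comul : tensorCoaction coact coact ∘ₗ Coalgebra.comul =
    LinearMap.lTensor H Coalgebra.comul ∘ₗ coact
  coact_antipode : coact ∘ₗ antipode = LinearMap.lTensor H antipode ∘ₗ coact
  counit_one : Coalgebra.counit (R := ℂ) (1 : B) = 1
  counit_mul : ∀ a b : B,
    Coalgebra.counit (R := ℂ) (a * b) = Coalgebra.counit a * Coalgebra.counit b
  comul_one : Coalgebra.comul (R := ℂ) (1 : B) = 1 ⊗ₜ 1
  comul_mul : Coalgebra.comul ∘ₗ LinearMap.mul' ℂ B =
    TensorProduct.map (LinearMap.mul' ℂ B) (LinearMap.mul' ℂ B) ∘ₗ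
      mid (braiding R coact coact) ∘ₗ TensorProduct.map Coalgebra.comul Coalgebra.comul
  antipode_left : LinearMap.mul' ℂ B ∘ₗ LinearMap.rTensor B antipode ∘ₗ Coalgebra.comul =
    Algebra.linearMap ℂ B ∘ₗ Coalgebra.counit
  antipode_right : LinearMap.mul' ℂ B ∘ₗ LinearMap.lTensor B antipode ∘ₗ Coalgebra.comul =
    Algebra.linearMap ℂ B ∘ₗ Coalgebra.counit

/-- `f` commutes with the coactions. -/
def IsComoduleMap {V W : Type*} [AddCommGroup V] [Module ℂ V] [AddCommGroup W] [Module ℂ W]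
    (δV : V →ₗ[ℂ] H ⊗[ℂ] V) (δW : W →ₗ[ℂ] H ⊗[ℂ] W) (f : V →ₗ[ℂ] W) : Prop :=
  δW ∘ₗ f = LinearMap.lTensor H f ∘ₗ δV

/-! ## Bosonization -/

section Bosonization

variable {B : Type*} [Ring B] [Algebra ℂ B] [Coalgebra ℂ B]

/-- `h ⊗ c ↦ R(c₍₁₎ ⊗ h₁) c₍₂₎ ⊗ h₂`. -/
def bosCross (R : H →ₗ[ℂ] H →ₗ[ℂ] ℂ) (δ : B →ₗ[ℂ] H ⊗[ℂ] B) : H ⊗[ℂ] B →ₗ[ℂ] B ⊗[ℂ] H :=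
  braiding R Coalgebra.comul δ

/-- `b ⊗ h ↦ b₍₁₎ h ⊗ b₍₂₎`. -/
def bosCocross (δ : B →ₗ[ℂ] H ⊗[ℂ] B) : B ⊗[ℂ] H →ₗ[ℂ] H ⊗[ℂ] B :=
  LinearMap.rTensor B (LinearMap.mul' ℂ H) ∘ₗ (TensorProduct.assoc ℂ H H B).symm.toLinearMap ∘ₗ
    LinearMap.lTensor H (TensorProduct.comm ℂ B H).toLinearMap ∘ₗ
    (TensorProduct.assoc ℂ H B H).toLinearMap ∘ₗ LinearMap.rTensor H δ

/-- The product `(b ⊗ h)(c ⊗ g) = R(c₍₁₎ ⊗ h₁) b c₍₂₎ ⊗ h₂ g` of the bosonization `B ⋊ H`,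
which is `B ⊗ H` as a vector space; its unit is `1 ⊗ 1`. -/
def bosMul (R : H →ₗ[ℂ] H →ₗ[ℂ] ℂ) (δ : B →ₗ[ℂ] H ⊗[ℂ] B) :
    (B ⊗[ℂ] H) ⊗[ℂ] (B ⊗[ℂ] H) →ₗ[ℂ] B ⊗[ℂ] H :=
  TensorProduct.map (LinearMap.mul' ℂ B) (LinearMap.mul' ℂ H) ∘ₗ mid (bosCross R δ)

/-- The coproduct `Δ(b ⊗ h) = (b₁ ⊗ b₂₍₁₎ h₁) ⊗ (b₂₍₂₎ ⊗ h₂)` of `B ⋊ H`. -/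
def bosComul (δ : B →ₗ[ℂ] H ⊗[ℂ] B) : B ⊗[ℂ] H →ₗ[ℂ] (B ⊗[ℂ] H) ⊗[ℂ] (B ⊗[ℂ] H) :=
  mid (bosCocross δ) ∘ₗ TensorProduct.map Coalgebra.comul Coalgebra.comul

variable (H B) in
/-- The projection `B ⋊ H → H`, `b ⊗ h ↦ ε(b) h`. -/
def bosProj : B ⊗[ℂ] H →ₗ[ℂ] H :=
  (TensorProduct.lid ℂ H).toLinearMap ∘ₗ LinearMap.rTensor H Coalgebra.counit

variable (H B) in
/-- The counit `b ⊗ h ↦ ε(b) ε(h)` of `B ⋊ H`. -/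
def bosCounit : B ⊗[ℂ] H →ₗ[ℂ] ℂ := Coalgebra.counit ∘ₗ bosProj H B

/-- The antipode
`S(b ⊗ h) = R((S b₍₂₎)₍₁₎ ⊗ (S(b₍₁₎ h))₁) (S b₍₂₎)₍₂₎ ⊗ (S(b₍₁₎ h))₂` of `B ⋊ H`. -/
def bosAntipode (R : H →ₗ[ℂ] H →ₗ[ℂ] ℂ) (δ : B →ₗ[ℂ] H ⊗[ℂ] B) (S : B →ₗ[ℂ] B) :
    B ⊗[ℂ] H →ₗ[ℂ] B ⊗[ℂ] H :=
  bosCross R δ ∘ₗ TensorProduct.map (HopfAlgebra.antipode ℂ) S ∘ₗ bosCocross δ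

variable (B) in
/-- The form `R((b ⊗ h) ⊗ (c ⊗ g)) = R(h ⊗ g) ε(b) ε(c)` on `B ⋊ H`. -/
def bosR (R : H →ₗ[ℂ] H →ₗ[ℂ] ℂ) : B ⊗[ℂ] H →ₗ[ℂ] B ⊗[ℂ] H →ₗ[ℂ] ℂ :=
  R.compl₁₂ (bosProj H B) (bosProj H B)

/-- The spin-statistics reduction of `B ⋊ H` with respect to `σ : B → H`: the largest subspace `W`
with `(id ⊗ σ̃ ⊗ id)(Δ² W) ⊆ W ⊗ (Δ H ∩ τ(Δ H)) ⊗ W`, where `σ̃ = σ ⊗ id : B ⋊ H → H ⊗ H` and `τ`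
is the flip. (Such subspaces are closed under sums, so that there is a largest one.) -/
def spinStatisticsReduction (δ : B →ₗ[ℂ] H ⊗[ℂ] B) (σ : B →ₗ[ℂ] H) : Submodule ℂ (B ⊗[ℂ] H) :=
  let D : Submodule ℂ (H ⊗[ℂ] H) :=
    LinearMap.range Coalgebra.comul ⊓
      (LinearMap.range Coalgebra.comul).map (TensorProduct.comm ℂ H H).toLinearMap
  sSup {W | W.map (TensorProduct.map LinearMap.id
        (TensorProduct.map (LinearMap.rTensor H σ) LinearMap.id) ∘ₗ
          LinearMap.lTensor (B ⊗[ℂ] H) (bosComul δ) ∘ₗ bosComul δ) ≤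
      LinearMap.range (TensorProduct.map W.subtype (TensorProduct.map D.subtype W.subtype))}

end Bosonization

/-! ## The triangular group extension problem -/

/-- A solution `σ : B ↠ H` of the triangular group extension problem for `H`, with the trivial
coaction of `H` on itself, in the category of left `H`-comodules: a braided commutative Hopf
algebra `B` in this category with a surjection `σ` of braided Hopf algebras onto `H`. -/
structure GroupExtension (R : H →ₗ[ℂ] H →ₗ[ℂ] ℂ) where
  B : Type u
  [ring : Ring B]
  [algebra : Algebra ℂ B]
  [coalgebra : Coalgebra ℂ B]
  hopf : BraidedHopfAlgebra R B
  braided_comm :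
    LinearMap.mul' ℂ B ∘ₗ braiding R hopf.coact hopf.coact = LinearMap.mul' ℂ B
  σ : B →ₐc[ℂ] H
  σ_surjective : Function.Surjective σ
  σ_comodule : IsComoduleMap hopf.coact (trivialCoaction H H) (σ : B →ₗ[ℂ] H)

attribute [instance] GroupExtension.ring GroupExtension.algebra GroupExtension.coalgebra

/-- For a quantum group extension `π : (A, RA) ↠ (H, R)`, the solution `σ : B ↠ H` of the
triangular group extension problem that corresponds to it, together with the identification `j` of
`A` with the spin-statistics reduction of `B ⋊ H`. Here `j` is an isomorphism of coquasitriangular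
Hopf algebras onto the reduction, the restriction of `σ̃ = σ ⊗ id` to the reduction is `Δ ∘ π`, and
`B ⋊ H` is the vector space `A ⊗ H` with `A` and `H` as subalgebras: the multiplication
`a ⊗ h ↦ j(a) (1 ⊗ h)` is bijective. -/
structure CorrespondingExtension {A : Type*} [Ring A] [HopfAlgebra ℂ A]
    (R : H →ₗ[ℂ] H →ₗ[ℂ] ℂ) (RA : A →ₗ[ℂ] A →ₗ[ℂ] ℂ) (π : A →ₐc[ℂ] H)
    extends GroupExtension.{u} R where
  j : A →ₗ[ℂ] B ⊗[ℂ] H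
  j_injective : Function.Injective j
  j_range : LinearMap.range j = spinStatisticsReduction hopf.coact (σ : B →ₗ[ℂ] H)
  j_one : j 1 = 1 ⊗ₜ 1
  j_mul : ∀ a b : A, j (a * b) = bosMul R hopf.coact (j a ⊗ₜ j b)
  j_comul : bosComul hopf.coact ∘ₗ j = TensorProduct.map j j ∘ₗ Coalgebra.comul
  j_counit : bosCounit H B ∘ₗ j = Coalgebra.counit
  j_antipode : bosAntipode R hopf.coact hopf.antipode ∘ₗ j = j ∘ₗ HopfAlgebra.antipode ℂ
  j_R : ∀ a b : A, bosR B R (j a) (j b) = RA a b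
  σ_j : ∀ a : A, LinearMap.rTensor H (σ : B →ₗ[ℂ] H) (j a) = Coalgebra.comul (π a)
  generate : Function.Bijective
    (bosMul R hopf.coact ∘ₗ TensorProduct.map j (TensorProduct.mk ℂ B H 1))

end General

/-! ## The quantum group `C'(ℤ₂)` -/

/-- The Hopf algebra `C(ℤ₂)`, with basis `g⁰ = 1`, `g¹ = g` (where `gⁱ = single i 1`), relation
`g² = 1` and `Δ g = g ⊗ g`, `ε(g) = 1`, `S g = g`. -/
abbrev CZ2 : Type := AddMonoidAlgebra ℂ (ZMod 2)

/-- The bilinear form `R(gⁱ ⊗ gᵏ) = (-1)^{ik}`, which turns `C(ℤ₂)` into the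
coquasitriangular Hopf algebra `C'(ℤ₂)`. -/
def signR : CZ2 →ₗ[ℂ] CZ2 →ₗ[ℂ] ℂ :=
  (AddMonoidAlgebra.basis (ZMod 2) ℂ).constr ℂ fun i =>
    (AddMonoidAlgebra.basis (ZMod 2) ℂ).constr ℂ fun k => (-1) ^ (i.val * k.val)

theorem signR_single (i k : ZMod 2) :
    signR (AddMonoidAlgebra.single i 1) (AddMonoidAlgebra.single k 1) =
      (-1) ^ (i.val * k.val) := by
  simp only [signR, ← AddMonoidAlgebra.basis_apply, Module.Basis.constr_basis]

theorem sign_add (a b c : ZMod 2) :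
    (-1 : ℂ) ^ ((a + b).val * c.val) = (-1) ^ (a.val * c.val) * (-1) ^ (b.val * c.val) := by
  rw [← pow_add, ← add_mul, neg_one_pow_congr]
  revert a b c; decide

theorem ext_CZ2 {M : Type*} [AddCommMonoid M] [Module ℂ M] {f g : CZ2 →ₗ[ℂ] M}
    (h : ∀ i, f (AddMonoidAlgebra.single i 1) = g (AddMonoidAlgebra.single i 1)) : f = g :=
  (AddMonoidAlgebra.basis (ZMod 2) ℂ).ext fun i => by simpa using h i

/-- `C'(ℤ₂)` is a coquasitriangular Hopf algebra. -/
theorem isCoquasitriangular_signR : IsCoquasitriangular signR where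
  mul_left a b c := by
    have : (LinearMap.mul ℂ CZ2).compr₂ signR =
      (LinearMap.mk₂ ℂ (fun a b =>
        LinearMap.mul' ℂ ℂ ∘ₗ TensorProduct.map (signR a) (signR b) ∘ₗ Coalgebra.comul)
       (by intros; ext; simp [TensorProduct.map_add_left, LinearMap.add_comp, LinearMap.comp_add])
       (by intros; ext; simp [TensorProduct.map_smul_left])
       (by intros; ext; simp [TensorProduct.map_add_right])
       (by intros; ext; simp [TensorProduct.map_smul_right])) := by
      refine ext_CZ2 fun i => ext_CZ2 fun k => ext_CZ2 fun l => ?_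
      simp [AddMonoidAlgebra.single_mul_single, signR_single, sign_add]
    exact LinearMap.congr_fun (LinearMap.congr_fun₂ this a b) c
  mul_right c a b := by
    have : (LinearMap.mul ℂ CZ2).compr₂ signR.flip =
      (LinearMap.mk₂ ℂ (fun a b =>
        LinearMap.mul' ℂ ℂ ∘ₗ TensorProduct.map (signR.flip b) (signR.flip a) ∘ₗ Coalgebra.comul)
       (by intros; ext; simp [TensorProduct.map_add_right])
       (by intros; ext; simp [TensorProduct.map_smul_right])
       (by intros; ext; simp [TensorProduct.map_add_left])
       (by intros; ext; simp [TensorProduct.map_smul_left])) := by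
      refine ext_CZ2 fun i => ext_CZ2 fun k => ext_CZ2 fun l => ?_
      have h := sign_add i k l
      simp only [mul_comm _ l.val] at h
      simp [AddMonoidAlgebra.single_mul_single, signR_single, h, mul_comm]
    exact LinearMap.congr_fun (LinearMap.congr_fun₂ this a b) c
  quasi_comm := by
    refine TensorProduct.ext (ext_CZ2 fun i => ext_CZ2 fun k => ?_)
    simp [AddMonoidAlgebra.single_mul_single, signR_single, add_comm, TensorProduct.comul_tmul]
  invertible := by
    have h : conv (TensorProduct.lift signR) (TensorProduct.lift signR) = Coalgebra.counit := by
      refine TensorProduct.ext (ext_CZ2 fun i => ext_CZ2 fun k => ?_)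
      simp [conv, signR_single, ← mul_pow, TensorProduct.comul_tmul]
    exact ⟨_, h, h⟩

end QG

end

/-! Composing the coproduct of `A` with `π` on either leg gives two commuting coactions of `C(ℤ₂)`,
that is, a bigrading of `A` by `ℤ₂ × ℤ₂`. The coproduct sends bidegree `(i, j)` into the sum over
`m` of `(i, m) ⊗ (m, j)`, the product adds bidegrees, the antipode swaps the two degrees, and `ε`
and `π` vanish unless `i = j`. Since the form on `A` is pulled back from `signR`,
quasi-commutativity reads `(-1)^(ik) ab = (-1)^(jl) ba` for `a` of bidegree `(i, j)` and `b` of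
bidegree `(k, l)` (`IsHomog.mul_comm`).

Existence: keep the coalgebra `A`, give bidegree `(i, j)` the degree `i + j`, and twist the product
by `(-1)^(j(k+l))`. Each axiom of a supercommutative Hopf algebra becomes an identity of exponents
in `ZMod 2`. The twist is the sign in the bosonized product of `a ⊗ gʲ` and `b ⊗ gˡ`, so that `a ↦ a
⊗ gʲ` embeds `A` as a Hopf algebra. Its image is the spin-statistics reduction (`range_embed`): a
functional vanishing on `Δ(C(ℤ₂))`, applied to the middle leg, kills every `a ⊗ gʲ` and fixes every
`a ⊗ gᵏ` with `k ≠ j`.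

Uniqueness: in any corresponding extension `j` is comultiplicative and its composite with the
projection to `C(ℤ₂)` is `π`, which forces `j(a) = base(a) ⊗ gʲ` (`j_eq`). This equation expresses
the grading, product, coproduct, counit and `σ` of `B` through those of `A`, and the bijectivity of
`a ⊗ h ↦ j(a)(1 ⊗ h)` makes `base` bijective. So `ρ` has to be `base ∘ φ ∘ base'⁻¹`, and this works
because `φ` preserves bidegrees. -/

noncomputable section

namespace QG

/-! ## The group Hopf algebra of `ℤ₂` -/

/-- The character `x ↦ (-1)ˣ` of `ℤ₂`. -/
def parity (x : ZMod 2) : ℂ := (-1) ^ x.val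

theorem parity_zero : parity 0 = 1 := by simp [parity]

theorem parity_add (x y : ZMod 2) : parity (x + y) = parity x * parity y := by
  unfold parity
  rw [← pow_add, neg_one_pow_congr]
  revert x y; decide

theorem parity_mul_self (x : ZMod 2) : parity x * parity x = 1 := by
  rw [← parity_add, CharTwo.add_self_eq_zero, parity_zero]

/-- The group-like element `gⁱ` of `C(ℤ₂)`. -/
def grp (i : ZMod 2) : CZ2 := AddMonoidAlgebra.single i 1

theorem grp_zero : grp 0 = 1 := rfl

theorem grp_mul (i k : ZMod 2) : grp i * grp k = grp (i + k) := by
  simp [grp, AddMonoidAlgebra.single_mul_single]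

theorem comul_grp (i : ZMod 2) : Coalgebra.comul (R := ℂ) (grp i) = grp i ⊗ₜ grp i := by
  simp [grp]

theorem counit_grp (i : ZMod 2) : Coalgebra.counit (R := ℂ) (grp i) = 1 := by
  simp [grp]

theorem antipode_grp (i : ZMod 2) : HopfAlgebra.antipode ℂ (grp i) = grp i := by
  simp [grp, ZModModule.neg_eq_self]

theorem signR_grp (i k : ZMod 2) : signR (grp i) (grp k) = parity (i * k) := by
  rw [grp, grp, signR_single, parity, neg_one_pow_congr]
  revert i k; decide

/-- The coefficient of `gⁱ`. -/
def grpCoord (i : ZMod 2) : CZ2 →ₗ[ℂ] ℂ := (AddMonoidAlgebra.basis (ZMod 2) ℂ).coord i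

theorem grpCoord_grp (i k : ZMod 2) : grpCoord i (grp k) = if k = i then 1 else 0 := by
  rw [grpCoord, grp, ← AddMonoidAlgebra.basis_apply, Module.Basis.coord_apply,
    Module.Basis.repr_self, Finsupp.single_apply]

theorem grp_tmul_injective (i : ZMod 2) {M : Type*} [AddCommGroup M] [Module ℂ M] {m n : M}
    (h : grp i ⊗ₜ[ℂ] m = grp i ⊗ₜ[ℂ] n) : m = n := by
  have := congrArg (TensorProduct.lid ℂ M ∘ LinearMap.rTensor M (grpCoord i)) h
  simpa [grpCoord_grp] using this

theorem tmul_grp_injective (i : ZMod 2) {M : Type*} [AddCommGroup M] [Module ℂ M] {m n : M}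
    (h : m ⊗ₜ[ℂ] grp i = n ⊗ₜ[ℂ] grp i) : m = n :=
  grp_tmul_injective i (by simpa using congrArg (TensorProduct.comm ℂ M CZ2) h)

theorem ext_grp {M : Type*} [AddCommMonoid M] [Module ℂ M] {f g : CZ2 →ₗ[ℂ] M}
    (h : ∀ i, f (grp i) = g (grp i)) : f = g := ext_CZ2 h

/-! ## Coactions of `C(ℤ₂)` are gradings -/

section Coaction

variable {V : Type*} [AddCommGroup V] [Module ℂ V]

/-- The component of degree `i` for a coaction of `C(ℤ₂)`. -/
def component (δ : V →ₗ[ℂ] CZ2 ⊗[ℂ] V) (i : ZMod 2) : V →ₗ[ℂ] V :=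
  (TensorProduct.lid ℂ V).toLinearMap ∘ₗ LinearMap.rTensor V (grpCoord i) ∘ₗ δ

theorem component_of_eq {δ : V →ₗ[ℂ] CZ2 ⊗[ℂ] V} {i : ZMod 2} {v : V}
    (h : δ v = grp i ⊗ₜ v) (k : ZMod 2) : component δ k v = if i = k then v else 0 := by
  simp [component, h, grpCoord_grp]

variable {δ : V →ₗ[ℂ] CZ2 ⊗[ℂ] V}

/-- Since `ε(gⁱ) = 1`, the counit of `C(ℤ₂)` is the sum of the coordinate functionals, and the
counit axiom is the decomposition into components. -/
theorem sum_component (hδ : IsCoaction δ) (v : V) : ∑ i, component δ i v = v := by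
  have h := LinearMap.congr_fun hδ.counit v
  have e : (Coalgebra.counit : CZ2 →ₗ[ℂ] ℂ) = ∑ i, grpCoord i :=
    ext_grp fun i => by simp [counit_grp, grpCoord_grp, -Fin.sum_univ_two]
  have e' : ∀ t : CZ2 ⊗[ℂ] V, LinearMap.rTensor V (∑ i, grpCoord i) t =
      ∑ i, LinearMap.rTensor V (grpCoord i) t := fun t => by
    simp [← LinearMap.coe_rTensorHom]
  rw [e] at h
  simpa [component, e'] using h

/-- This is coassociativity with the `i`-th coordinate functional applied to the first leg; the
group-like `gⁱ` survives in the second leg. -/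
theorem coact_component (hδ : IsCoaction δ) (i : ZMod 2) (v : V) :
    δ (component δ i v) = grp i ⊗ₜ component δ i v := by
  have h := congrArg ((TensorProduct.lid ℂ (CZ2 ⊗[ℂ] V)).toLinearMap ∘ₗ
    LinearMap.rTensor (CZ2 ⊗[ℂ] V) (grpCoord i)) (LinearMap.congr_fun hδ.coassoc v)
  have h₁ : ((TensorProduct.lid ℂ (CZ2 ⊗[ℂ] V)).toLinearMap ∘ₗ
      LinearMap.rTensor (CZ2 ⊗[ℂ] V) (grpCoord i)) ∘ₗ
      (TensorProduct.assoc ℂ CZ2 CZ2 V).toLinearMap ∘ₗ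
      LinearMap.rTensor V Coalgebra.comul =
      TensorProduct.mk ℂ CZ2 V (grp i) ∘ₗ (TensorProduct.lid ℂ V).toLinearMap ∘ₗ
        LinearMap.rTensor V (grpCoord i) := by
    refine TensorProduct.ext (ext_grp fun k => LinearMap.ext fun w => ?_)
    by_cases hk : k = i <;> simp [comul_grp, grpCoord_grp, hk]
  have h₂ : ((TensorProduct.lid ℂ (CZ2 ⊗[ℂ] V)).toLinearMap ∘ₗ
      LinearMap.rTensor (CZ2 ⊗[ℂ] V) (grpCoord i)) ∘ₗ LinearMap.lTensor CZ2 δ =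
      δ ∘ₗ (TensorProduct.lid ℂ V).toLinearMap ∘ₗ LinearMap.rTensor V (grpCoord i) := by
    refine TensorProduct.ext (ext_grp fun k => LinearMap.ext fun w => ?_)
    simp
  have h₁' := LinearMap.congr_fun h₁ (δ v)
  have h₂' := LinearMap.congr_fun h₂ (δ v)
  exact (h₂'.symm.trans h.symm).trans h₁'

end Coaction

/-! ## The bigrading of a Hopf algebra over `C(ℤ₂)` -/

section Bigrading

variable {A : Type*} [Ring A] [HopfAlgebra ℂ A] (π : A →ₐc[ℂ] CZ2)

/-- The left coaction `a ↦ π(a₁) ⊗ a₂`. -/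
def leftCoact : A →ₗ[ℂ] CZ2 ⊗[ℂ] A :=
  LinearMap.rTensor A (π : A →ₗ[ℂ] CZ2) ∘ₗ Coalgebra.comul

/-- The right coaction `a ↦ π(a₂) ⊗ a₁`, seen as a left coaction. -/
def rightCoact : A →ₗ[ℂ] CZ2 ⊗[ℂ] A :=
  (TensorProduct.comm ℂ A CZ2).toLinearMap ∘ₗ
    LinearMap.lTensor A (π : A →ₗ[ℂ] CZ2) ∘ₗ Coalgebra.comul

theorem comul_comp_hom : Coalgebra.comul ∘ₗ (π : A →ₗ[ℂ] CZ2) =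
    TensorProduct.map (π : A →ₗ[ℂ] CZ2) (π : A →ₗ[ℂ] CZ2) ∘ₗ Coalgebra.comul :=
  (CoalgHomClass.map_comp_comul π).symm

theorem isCoaction_leftCoact : IsCoaction (leftCoact π) where
  coassoc := by
    have e : LinearMap.rTensor A Coalgebra.comul ∘ₗ LinearMap.rTensor A (π : A →ₗ[ℂ] CZ2) =
        LinearMap.rTensor A (TensorProduct.map (π : A →ₗ[ℂ] CZ2) (π : A →ₗ[ℂ] CZ2)) ∘ₗ
          LinearMap.rTensor A Coalgebra.comul := by
      rw [← LinearMap.rTensor_comp, comul_comp_hom, LinearMap.rTensor_comp]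
    have e₁ : (TensorProduct.assoc ℂ CZ2 CZ2 A).toLinearMap ∘ₗ
        LinearMap.rTensor A (TensorProduct.map (π : A →ₗ[ℂ] CZ2) (π : A →ₗ[ℂ] CZ2)) =
        TensorProduct.map (π : A →ₗ[ℂ] CZ2) (LinearMap.rTensor A (π : A →ₗ[ℂ] CZ2)) ∘ₗ
          (TensorProduct.assoc ℂ A A A).toLinearMap :=
      TensorProduct.ext_threefold fun _ _ _ => rfl
    have e₂ : LinearMap.lTensor CZ2 (leftCoact π) ∘ₗ LinearMap.rTensor A (π : A →ₗ[ℂ] CZ2) =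
        TensorProduct.map (π : A →ₗ[ℂ] CZ2) (LinearMap.rTensor A (π : A →ₗ[ℂ] CZ2)) ∘ₗ
          LinearMap.lTensor A Coalgebra.comul :=
      TensorProduct.ext' fun _ _ => rfl
    ext a
    have h := Coalgebra.coassoc_apply (R := ℂ) a
    have h₀ := LinearMap.congr_fun e (Coalgebra.comul a)
    have h₁ := LinearMap.congr_fun e₁ (LinearMap.rTensor A Coalgebra.comul (Coalgebra.comul a))
    have h₂ := LinearMap.congr_fun e₂ (Coalgebra.comul a)
    simp only [LinearMap.comp_apply, LinearEquiv.coe_coe] at h h₀ h₁ h₂ ⊢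
    rw [leftCoact] at h₂ ⊢
    simp only [LinearMap.comp_apply] at h₂ ⊢
    rw [h₀, h₁, h]
    exact h₂.symm
  counit := by
    have e : LinearMap.rTensor A Coalgebra.counit ∘ₗ LinearMap.rTensor A (π : A →ₗ[ℂ] CZ2) =
        LinearMap.rTensor A Coalgebra.counit := by
      rw [← LinearMap.rTensor_comp]; congr 1; exact CoalgHomClass.counit_comp π
    rw [leftCoact, ← LinearMap.comp_assoc (Coalgebra.comul : A →ₗ[ℂ] _), e]
    ext a
    simp

theorem isCoaction_rightCoact : IsCoaction (rightCoact π) where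
  coassoc := by
    have e : LinearMap.lTensor A Coalgebra.comul ∘ₗ LinearMap.lTensor A (π : A →ₗ[ℂ] CZ2) =
        LinearMap.lTensor A (TensorProduct.map (π : A →ₗ[ℂ] CZ2) (π : A →ₗ[ℂ] CZ2)) ∘ₗ
          LinearMap.lTensor A Coalgebra.comul := by
      rw [← LinearMap.lTensor_comp, comul_comp_hom, LinearMap.lTensor_comp]
    -- Cocommutativity of `C(ℤ₂)`: the flip of the two group factors can be inserted freely, which
    -- is what lets a right coaction count as a left one.
    have e₀ : (TensorProduct.assoc ℂ CZ2 CZ2 A).toLinearMap ∘ₗ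
        LinearMap.rTensor A Coalgebra.comul ∘ₗ (TensorProduct.comm ℂ A CZ2).toLinearMap =
        (TensorProduct.assoc ℂ CZ2 CZ2 A).toLinearMap ∘ₗ
        LinearMap.rTensor A (TensorProduct.comm ℂ CZ2 CZ2).toLinearMap ∘ₗ
        (TensorProduct.comm ℂ A (CZ2 ⊗[ℂ] CZ2)).toLinearMap ∘ₗ
          LinearMap.lTensor A Coalgebra.comul := by
      refine TensorProduct.ext (LinearMap.ext fun a => ext_grp fun k => ?_)
      simp [comul_grp]
    have e₁ : (TensorProduct.assoc ℂ CZ2 CZ2 A).toLinearMap ∘ₗ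
        LinearMap.rTensor A (TensorProduct.comm ℂ CZ2 CZ2).toLinearMap ∘ₗ
        (TensorProduct.comm ℂ A (CZ2 ⊗[ℂ] CZ2)).toLinearMap ∘ₗ
        LinearMap.lTensor A (TensorProduct.map (π : A →ₗ[ℂ] CZ2) (π : A →ₗ[ℂ] CZ2)) ∘ₗ
        (TensorProduct.assoc ℂ A A A).toLinearMap =
        LinearMap.lTensor CZ2 ((TensorProduct.comm ℂ A CZ2).toLinearMap ∘ₗ
          LinearMap.lTensor A (π : A →ₗ[ℂ] CZ2)) ∘ₗ
          (TensorProduct.comm ℂ (A ⊗[ℂ] A) CZ2).toLinearMap ∘ₗ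
          LinearMap.lTensor (A ⊗[ℂ] A) (π : A →ₗ[ℂ] CZ2) :=
      TensorProduct.ext_threefold fun _ _ _ => rfl
    have e₂ : LinearMap.lTensor CZ2 (rightCoact π) ∘ₗ (TensorProduct.comm ℂ A CZ2).toLinearMap ∘ₗ
        LinearMap.lTensor A (π : A →ₗ[ℂ] CZ2) =
        (LinearMap.lTensor CZ2 ((TensorProduct.comm ℂ A CZ2).toLinearMap ∘ₗ
          LinearMap.lTensor A (π : A →ₗ[ℂ] CZ2)) ∘ₗ
          (TensorProduct.comm ℂ (A ⊗[ℂ] A) CZ2).toLinearMap ∘ₗ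
          LinearMap.lTensor (A ⊗[ℂ] A) (π : A →ₗ[ℂ] CZ2)) ∘ₗ
          LinearMap.rTensor A Coalgebra.comul :=
      TensorProduct.ext' fun _ _ => rfl
    ext a
    have h := Coalgebra.coassoc_apply (R := ℂ) a
    have h' := LinearMap.congr_fun e₀ (LinearMap.lTensor A (π : A →ₗ[ℂ] CZ2) (Coalgebra.comul a))
    have h₀ := LinearMap.congr_fun e (Coalgebra.comul a)
    have h₁ := LinearMap.congr_fun e₁ (LinearMap.rTensor A Coalgebra.comul (Coalgebra.comul a))
    have h₂ := LinearMap.congr_fun e₂ (Coalgebra.comul a)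
    simp only [LinearMap.comp_apply, LinearEquiv.coe_coe] at h h' h₀ h₁ h₂ ⊢
    rw [h₀, ← h] at h'
    rw [h₁] at h'
    exact h'.trans h₂.symm
  counit := by
    have e : LinearMap.lTensor A Coalgebra.counit ∘ₗ LinearMap.lTensor A (π : A →ₗ[ℂ] CZ2) =
        LinearMap.lTensor A Coalgebra.counit := by
      rw [← LinearMap.lTensor_comp]; congr 1; exact CoalgHomClass.counit_comp π
    have e' : (TensorProduct.lid ℂ A).toLinearMap ∘ₗ
        LinearMap.rTensor A Coalgebra.counit ∘ₗ (TensorProduct.comm ℂ A CZ2).toLinearMap =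
        (TensorProduct.rid ℂ A).toLinearMap ∘ₗ LinearMap.lTensor A Coalgebra.counit :=
      TensorProduct.ext' fun a h => by simp
    ext a
    have h := LinearMap.congr_fun e (Coalgebra.comul a)
    have h' := LinearMap.congr_fun e' (LinearMap.lTensor A (π : A →ₗ[ℂ] CZ2) (Coalgebra.comul a))
    simp only [LinearMap.comp_apply, LinearEquiv.coe_coe] at h h'
    rw [h] at h'
    refine h'.trans ?_
    simp

end Bigrading

/-! ### Homogeneous elements and the projections to bidegrees -/

section Homogeneous

variable {A : Type*} [Ring A] [HopfAlgebra ℂ A] (π : A →ₐc[ℂ] CZ2)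

/-- `a` is homogeneous of degree `i` for the left and of degree `j` for the right coaction. -/
structure IsHomog (i j : ZMod 2) (a : A) : Prop where
  left : leftCoact π a = grp i ⊗ₜ a
  right : rightCoact π a = grp j ⊗ₜ a

/-- The projection to the elements of left degree `i`. -/
def leftProj (i : ZMod 2) : A →ₗ[ℂ] A := component (leftCoact π) i

/-- The projection to the elements of right degree `j`. -/
def rightProj (j : ZMod 2) : A →ₗ[ℂ] A := component (rightCoact π) j

/-- The projection to the elements of bidegree `(i, j)`. -/
def biProj (i j : ZMod 2) : A →ₗ[ℂ] A := leftProj π i ∘ₗ rightProj π j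

/-- In this form the projections are slices of the coproduct by the functional `grpCoord i ∘ π`. The
commutation rules below are then instances of coassociativity, valid for any functional `f`. -/
theorem leftProj_eq (i : ZMod 2) : leftProj π i = (TensorProduct.lid ℂ A).toLinearMap ∘ₗ
    LinearMap.rTensor A (grpCoord i ∘ₗ (π : A →ₗ[ℂ] CZ2)) ∘ₗ Coalgebra.comul := by
  rw [LinearMap.rTensor_comp]; rfl

theorem rightProj_eq (i : ZMod 2) : rightProj π i = (TensorProduct.rid ℂ A).toLinearMap ∘ₗ
    LinearMap.lTensor A (grpCoord i ∘ₗ (π : A →ₗ[ℂ] CZ2)) ∘ₗ Coalgebra.comul := by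
  rw [LinearMap.lTensor_comp, rightProj, component, rightCoact]
  simp only [← LinearMap.comp_assoc]
  congr 2
  exact TensorProduct.ext' fun a h => by simp

theorem sum_leftProj (a : A) : ∑ i, leftProj π i a = a :=
  sum_component (isCoaction_leftCoact π) a

theorem sum_rightProj (a : A) : ∑ i, rightProj π i a = a :=
  sum_component (isCoaction_rightCoact π) a

theorem comul_leftProj (i : ZMod 2) (a : A) : Coalgebra.comul (R := ℂ) (leftProj π i a) =
    LinearMap.rTensor A (leftProj π i) (Coalgebra.comul a) := by
  rw [leftProj_eq]
  generalize grpCoord i ∘ₗ (π : A →ₗ[ℂ] CZ2) = f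
  have e₁ : Coalgebra.comul ∘ₗ (TensorProduct.lid ℂ A).toLinearMap ∘ₗ LinearMap.rTensor A f =
      (TensorProduct.lid ℂ (A ⊗[ℂ] A)).toLinearMap ∘ₗ LinearMap.rTensor (A ⊗[ℂ] A) f ∘ₗ
        LinearMap.lTensor A Coalgebra.comul := TensorProduct.ext' fun _ _ => by simp
  have e₂ : (TensorProduct.lid ℂ (A ⊗[ℂ] A)).toLinearMap ∘ₗ LinearMap.rTensor (A ⊗[ℂ] A) f ∘ₗ
      (TensorProduct.assoc ℂ A A A).toLinearMap =
      LinearMap.rTensor A ((TensorProduct.lid ℂ A).toLinearMap ∘ₗ LinearMap.rTensor A f) :=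
    TensorProduct.ext_threefold fun _ _ _ => by simp [TensorProduct.smul_tmul']
  have h₁ := LinearMap.congr_fun e₁ (Coalgebra.comul a)
  have h₂ := LinearMap.congr_fun e₂ (LinearMap.rTensor A Coalgebra.comul (Coalgebra.comul a))
  have h := Coalgebra.coassoc_apply (R := ℂ) a
  simp only [LinearMap.comp_apply, LinearEquiv.coe_coe] at h h₁ h₂ ⊢
  rw [h₁, ← h, h₂]
  simp only [LinearMap.rTensor_comp, LinearMap.comp_apply]

theorem comul_rightProj (i : ZMod 2) (a : A) : Coalgebra.comul (R := ℂ) (rightProj π i a) =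
    LinearMap.lTensor A (rightProj π i) (Coalgebra.comul a) := by
  rw [rightProj_eq]
  generalize grpCoord i ∘ₗ (π : A →ₗ[ℂ] CZ2) = f
  have e₁ : Coalgebra.comul ∘ₗ (TensorProduct.rid ℂ A).toLinearMap ∘ₗ LinearMap.lTensor A f =
      (TensorProduct.rid ℂ (A ⊗[ℂ] A)).toLinearMap ∘ₗ LinearMap.lTensor (A ⊗[ℂ] A) f ∘ₗ
        LinearMap.rTensor A Coalgebra.comul := TensorProduct.ext' fun _ _ => by simp
  have e₂ : (TensorProduct.rid ℂ (A ⊗[ℂ] A)).toLinearMap ∘ₗ LinearMap.lTensor (A ⊗[ℂ] A) f =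
      LinearMap.lTensor A ((TensorProduct.rid ℂ A).toLinearMap ∘ₗ LinearMap.lTensor A f) ∘ₗ
      (TensorProduct.assoc ℂ A A A).toLinearMap :=
    TensorProduct.ext_threefold fun _ _ _ => by simp [TensorProduct.smul_tmul']
  have h₁ := LinearMap.congr_fun e₁ (Coalgebra.comul a)
  have h₂ := LinearMap.congr_fun e₂ (LinearMap.rTensor A Coalgebra.comul (Coalgebra.comul a))
  have h := Coalgebra.coassoc_apply (R := ℂ) a
  simp only [LinearMap.comp_apply, LinearEquiv.coe_coe] at h h₁ h₂ ⊢
  rw [h₁, h₂, h]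
  simp only [LinearMap.lTensor_comp, LinearMap.comp_apply]

/-- Both sides are `a₁ f(a₂) ⊗ a₃`. Hence the inner degrees of the two legs of a coproduct always
agree. -/
theorem rightProj_comul (i : ZMod 2) (a : A) :
    LinearMap.rTensor A (rightProj π i) (Coalgebra.comul a) =
      LinearMap.lTensor A (leftProj π i) (Coalgebra.comul a) := by
  rw [leftProj_eq, rightProj_eq]
  generalize grpCoord i ∘ₗ (π : A →ₗ[ℂ] CZ2) = f
  have e : LinearMap.lTensor A ((TensorProduct.lid ℂ A).toLinearMap ∘ₗ LinearMap.rTensor A f) ∘ₗ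
        (TensorProduct.assoc ℂ A A A).toLinearMap =
      LinearMap.rTensor A ((TensorProduct.rid ℂ A).toLinearMap ∘ₗ LinearMap.lTensor A f) :=
    TensorProduct.ext_threefold fun _ _ _ => by simp [TensorProduct.smul_tmul']
  have h₂ := LinearMap.congr_fun e (LinearMap.rTensor A Coalgebra.comul (Coalgebra.comul a))
  have h := Coalgebra.coassoc_apply (R := ℂ) a
  simp only [LinearMap.comp_apply, LinearEquiv.coe_coe] at h h₂ ⊢
  rw [h] at h₂
  simp only [LinearMap.lTensor_comp, LinearMap.rTensor_comp, LinearMap.comp_apply] at h₂ ⊢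
  exact h₂.symm

theorem leftProj_rightProj (i j : ZMod 2) (a : A) :
    leftProj π i (rightProj π j a) = rightProj π j (leftProj π i a) := by
  conv_lhs => rw [leftProj_eq]
  conv_rhs => rw [leftProj_eq]
  generalize grpCoord i ∘ₗ (π : A →ₗ[ℂ] CZ2) = f
  have e : ((TensorProduct.lid ℂ A).toLinearMap ∘ₗ LinearMap.rTensor A f) ∘ₗ
      LinearMap.lTensor A (rightProj π j) =
      rightProj π j ∘ₗ (TensorProduct.lid ℂ A).toLinearMap ∘ₗ LinearMap.rTensor A f :=
    TensorProduct.ext' fun _ _ => by simp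
  have h := LinearMap.congr_fun e (Coalgebra.comul a)
  simp only [LinearMap.comp_apply] at h ⊢
  rw [comul_rightProj, h]

theorem isHomog_biProj (i j : ZMod 2) (a : A) : IsHomog π i j (biProj π i j a) where
  left := coact_component (isCoaction_leftCoact π) i _
  right := by
    rw [biProj, LinearMap.comp_apply, leftProj_rightProj]
    exact coact_component (isCoaction_rightCoact π) j _

theorem sum_biProj (a : A) : ∑ i, ∑ j, biProj π i j a = a := by
  simp_rw [biProj, LinearMap.comp_apply, ← map_sum, sum_rightProj, sum_leftProj]

variable {π}

/-- Linear maps that agree on the homogeneous elements are equal. -/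
theorem ext_homog {M : Type*} [AddCommMonoid M] [Module ℂ M] {f g : A →ₗ[ℂ] M}
    (h : ∀ i j a, IsHomog π i j a → f a = g a) : f = g := by
  ext a
  rw [← sum_biProj π a]
  simp_rw [map_sum]
  exact Finset.sum_congr rfl fun i _ => Finset.sum_congr rfl fun j _ =>
    h i j _ (isHomog_biProj π i j a)

namespace IsHomog

variable {i j k l : ZMod 2} {a b : A}

theorem leftProj_eq (h : IsHomog π i j a) (k : ZMod 2) :
    leftProj π k a = if i = k then a else 0 := component_of_eq h.left k

theorem rightProj_eq (h : IsHomog π i j a) (k : ZMod 2) :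
    rightProj π k a = if j = k then a else 0 := component_of_eq h.right k

theorem biProj_eq (h : IsHomog π i j a) (k l : ZMod 2) :
    biProj π k l a = if i = k ∧ j = l then a else 0 := by
  rw [biProj, LinearMap.comp_apply, h.rightProj_eq]
  split_ifs with h₁ h₂ h₂
  · rw [h.leftProj_eq, if_pos h₂.1]
  · rw [h.leftProj_eq, if_neg fun h₃ => h₂ ⟨h₃, h₁⟩]
  · exact absurd h₂.2 h₁
  · exact map_zero _

/-- The coproduct of an element of bidegree `(i, j)` is a sum of tensors of elements of bidegrees
`(i, m)` and `(m, j)`. -/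
theorem comul_mem (h : IsHomog π i j a) : Coalgebra.comul (R := ℂ) a ∈
    Submodule.span ℂ {t | ∃ m x y, IsHomog π i m x ∧ IsHomog π m j y ∧ t = x ⊗ₜ[ℂ] y} := by
  have e : Coalgebra.comul (R := ℂ) a =
      ∑ m, TensorProduct.map (biProj π i m) (biProj π m j) (Coalgebra.comul a) := by
    -- The outer projections act trivially on `Δ a` because `a` has bidegree `(i, j)`; the two inner
    -- ones coincide there by `rightProj_comul` and merge by idempotence.
    have h₁ : ∀ m, TensorProduct.map (biProj π i m) (biProj π m j) (Coalgebra.comul a) =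
        LinearMap.rTensor A (rightProj π m) (Coalgebra.comul a) := fun m => by
      have e₁ : TensorProduct.map (biProj π i m) (biProj π m j) =
          LinearMap.rTensor A (rightProj π m) ∘ₗ LinearMap.lTensor A (leftProj π m) ∘ₗ
          LinearMap.rTensor A (leftProj π i) ∘ₗ LinearMap.lTensor A (rightProj π j) :=
        TensorProduct.ext' fun x y => by simp [biProj, leftProj_rightProj]
      have e₂ : LinearMap.rTensor A (rightProj π m) ∘ₗ LinearMap.rTensor A (rightProj π m) =
          LinearMap.rTensor A (rightProj π m) := by
        rw [← LinearMap.rTensor_comp]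
        congr 1
        refine LinearMap.ext fun x => ?_
        exact (component_of_eq (coact_component (isCoaction_rightCoact π) m x) m).trans (if_pos rfl)
      rw [e₁]
      simp only [LinearMap.comp_apply]
      rw [← comul_rightProj, ← comul_leftProj, h.rightProj_eq, if_pos rfl, h.leftProj_eq,
        if_pos rfl, ← rightProj_comul]
      exact LinearMap.congr_fun e₂ _
    simp_rw [h₁]
    have e₃ : ∀ t : A ⊗[ℂ] A, ∑ m, LinearMap.rTensor A (rightProj π m) t = t := fun t => by
      induction t with
      | zero => simp
      | tmul x y => simp_rw [LinearMap.rTensor_tmul, ← TensorProduct.sum_tmul, sum_rightProj]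
      | add x y hx hy => simp_rw [map_add, Finset.sum_add_distrib, hx, hy]
    exact (e₃ _).symm
  rw [e]
  refine Submodule.sum_mem _ fun m _ => ?_
  generalize Coalgebra.comul (R := ℂ) a = t
  induction t with
  | zero => simp
  | tmul x y =>
    exact Submodule.subset_span ⟨m, _, _, isHomog_biProj π i m x, isHomog_biProj π m j y, rfl⟩
  | add x y hx hy => rw [map_add]; exact Submodule.add_mem _ hx hy

/-- Linear maps that agree on the tensors of elements of bidegrees `(i, m)` and `(m, j)` agree on
the coproduct of an element of bidegree `(i, j)`. -/
theorem comul_congr (h : IsHomog π i j a) {M : Type*} [AddCommMonoid M] [Module ℂ M]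
    {f g : A ⊗[ℂ] A →ₗ[ℂ] M}
    (hfg : ∀ m x y, IsHomog π i m x → IsHomog π m j y → f (x ⊗ₜ y) = g (x ⊗ₜ y)) :
    f (Coalgebra.comul a) = g (Coalgebra.comul a) := by
  refine LinearMap.eqOn_span (f := f) (g := g) ?_ h.comul_mem
  rintro _ ⟨m, x, y, hx, hy, rfl⟩
  exact hfg m x y hx hy

variable (π) in
theorem one : IsHomog π 0 0 (1 : A) :=
  ⟨by simp [leftCoact, grp_zero, Algebra.TensorProduct.one_def],
    by simp [rightCoact, grp_zero, Algebra.TensorProduct.one_def]⟩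

/-- Both coactions are composites of algebra homomorphisms. -/
theorem mul (ha : IsHomog π i j a) (hb : IsHomog π k l b) : IsHomog π (i + k) (j + l) (a * b) := by
  have eL : ∀ x : A, leftCoact π x = Algebra.TensorProduct.map (π : A →ₐ[ℂ] CZ2) (AlgHom.id ℂ A)
      (Bialgebra.comulAlgHom ℂ A x) := fun x => rfl
  have eR : ∀ x : A, rightCoact π x = Algebra.TensorProduct.comm ℂ A CZ2
      (Algebra.TensorProduct.map (AlgHom.id ℂ A) (π : A →ₐ[ℂ] CZ2)
      (Bialgebra.comulAlgHom ℂ A x)) := fun x => rfl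
  constructor
  · rw [eL, map_mul, map_mul, ← eL, ← eL, ha.left, hb.left, Algebra.TensorProduct.tmul_mul_tmul,
      grp_mul]
  · rw [eR, map_mul, map_mul, map_mul, ← eR, ← eR, ha.right, hb.right,
      Algebra.TensorProduct.tmul_mul_tmul, grp_mul]

theorem map_left (h : IsHomog π i j a) : π a = Coalgebra.counit (R := ℂ) a • grp i := by
  have := congrArg ((TensorProduct.rid ℂ CZ2).toLinearMap ∘ₗ
    LinearMap.lTensor CZ2 Coalgebra.counit) h.left
  have e : ((TensorProduct.rid ℂ CZ2).toLinearMap ∘ₗ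
    LinearMap.lTensor CZ2 Coalgebra.counit) ∘ₗ LinearMap.rTensor A (π : A →ₗ[ℂ] CZ2) =
      (π : A →ₗ[ℂ] CZ2) ∘ₗ (TensorProduct.rid ℂ A).toLinearMap ∘ₗ
        LinearMap.lTensor A Coalgebra.counit := TensorProduct.ext' fun x y => by simp
  have e' := LinearMap.congr_fun e (Coalgebra.comul a)
  simpa using e'.symm.trans this

theorem map_right (h : IsHomog π i j a) : π a = Coalgebra.counit (R := ℂ) a • grp j := by
  have := congrArg ((TensorProduct.rid ℂ CZ2).toLinearMap ∘ₗ
    LinearMap.lTensor CZ2 Coalgebra.counit) h.right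
  have e : ((TensorProduct.rid ℂ CZ2).toLinearMap ∘ₗ
    LinearMap.lTensor CZ2 Coalgebra.counit) ∘ₗ (TensorProduct.comm ℂ A CZ2).toLinearMap ∘ₗ
      LinearMap.lTensor A (π : A →ₗ[ℂ] CZ2) =
      (π : A →ₗ[ℂ] CZ2) ∘ₗ (TensorProduct.lid ℂ A).toLinearMap ∘ₗ
        LinearMap.rTensor A Coalgebra.counit := TensorProduct.ext' fun x y => by simp
  have e' := LinearMap.congr_fun e (Coalgebra.comul a)
  simpa using e'.symm.trans this

/-- Applying `id ⊗ ε` to either coaction gives `π a = ε(a) gⁱ = ε(a) gʲ`. Thus `ε` and `π` only see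
bidegrees `(i, i)`, which have even total degree; there most of the signs below are trivial. -/
theorem counit_eq_zero (h : IsHomog π i j a) (hij : i ≠ j) : Coalgebra.counit (R := ℂ) a = 0 := by
  have := congrArg (grpCoord i) (h.map_left.symm.trans h.map_right)
  simpa [grpCoord_grp, hij.symm] using this

theorem map_comp {A' : Type*} [Ring A'] [HopfAlgebra ℂ A'] {φ : A' →ₐc[ℂ] A} {a : A'}
    (h : IsHomog (π.comp φ) i j a) : IsHomog π i j (φ a) := by
  have hφ := LinearMap.congr_fun (CoalgHomClass.map_comp_comul φ) a
  have e₁ : LinearMap.rTensor A (π : A →ₗ[ℂ] CZ2) ∘ₗ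
      TensorProduct.map (φ : A' →ₗ[ℂ] A) (φ : A' →ₗ[ℂ] A) =
      LinearMap.lTensor CZ2 (φ : A' →ₗ[ℂ] A) ∘ₗ
        LinearMap.rTensor A' ((π.comp φ : A' →ₐc[ℂ] CZ2) : A' →ₗ[ℂ] CZ2) :=
    TensorProduct.ext' fun _ _ => rfl
  have e₂ : (TensorProduct.comm ℂ A CZ2).toLinearMap ∘ₗ LinearMap.lTensor A (π : A →ₗ[ℂ] CZ2) ∘ₗ
      TensorProduct.map (φ : A' →ₗ[ℂ] A) (φ : A' →ₗ[ℂ] A) =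
      LinearMap.lTensor CZ2 (φ : A' →ₗ[ℂ] A) ∘ₗ (TensorProduct.comm ℂ A' CZ2).toLinearMap ∘ₗ
        LinearMap.lTensor A' ((π.comp φ : A' →ₐc[ℂ] CZ2) : A' →ₗ[ℂ] CZ2) :=
    TensorProduct.ext' fun _ _ => rfl
  have e₁' := LinearMap.congr_fun e₁ (Coalgebra.comul a)
  have e₂' := LinearMap.congr_fun e₂ (Coalgebra.comul a)
  constructor
  · calc leftCoact π (φ a) = LinearMap.rTensor A (π : A →ₗ[ℂ] CZ2) (Coalgebra.comul (φ a)) := rfl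
      _ = LinearMap.lTensor CZ2 (φ : A' →ₗ[ℂ] A) (leftCoact (π.comp φ) a) :=
        (congrArg _ hφ.symm).trans e₁'
      _ = _ := by rw [h.left]; rfl
  · calc rightCoact π (φ a) = ((TensorProduct.comm ℂ A CZ2).toLinearMap ∘ₗ
          LinearMap.lTensor A (π : A →ₗ[ℂ] CZ2)) (Coalgebra.comul (φ a)) := rfl
      _ = LinearMap.lTensor CZ2 (φ : A' →ₗ[ℂ] A) (rightCoact (π.comp φ) a) :=
        (congrArg _ hφ.symm).trans e₂'
      _ = _ := by rw [h.right]; rfl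

end IsHomog

end Homogeneous

/-! ### Commutation signs and the antipode in terms of bidegrees -/

section QuasiCommutative

variable {A : Type*} [Ring A] [HopfAlgebra ℂ A] {π : A →ₐc[ℂ] CZ2} {RA : A →ₗ[ℂ] A →ₗ[ℂ] ℂ}
  {i j k l : ZMod 2} {a b : A}

/-- Because the form is pulled back along `π`, the two sides of the quasi-commutativity axiom depend
on `a` and `b` only through their left coactions and their right coactions respectively; on
homogeneous elements these contribute the two signs. -/
theorem IsHomog.mul_comm (ha : IsHomog π i j a) (hb : IsHomog π k l b)
    (hRA : IsCoquasitriangular RA) (hπ : IsQuantumGroupSurjection RA signR π) :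
    parity (i * k) • (a * b) = parity (j * l) • (b * a) := by
  have h := LinearMap.congr_fun hRA.quasi_comm (a ⊗ₜ[ℂ] b)
  have e₁ : (TensorProduct.lid ℂ A).toLinearMap ∘ₗ
      TensorProduct.map (TensorProduct.lift RA) (LinearMap.mul' ℂ A) ∘ₗ
      (TensorProduct.tensorTensorTensorComm ℂ A A A A).toLinearMap =
      ((TensorProduct.lid ℂ A).toLinearMap ∘ₗ
        TensorProduct.map (TensorProduct.lift signR) (LinearMap.mul' ℂ A) ∘ₗ
        (TensorProduct.tensorTensorTensorComm ℂ CZ2 A CZ2 A).toLinearMap) ∘ₗ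
      TensorProduct.map (LinearMap.rTensor A (π : A →ₗ[ℂ] CZ2))
        (LinearMap.rTensor A (π : A →ₗ[ℂ] CZ2)) :=
    TensorProduct.ext_fourfold' fun x y z w => by simp [← hπ.pullback]
  have e₂ : (TensorProduct.rid ℂ A).toLinearMap ∘ₗ
      TensorProduct.map (LinearMap.mul' ℂ A ∘ₗ (TensorProduct.comm ℂ A A).toLinearMap)
        (TensorProduct.lift RA) ∘ₗ
      (TensorProduct.tensorTensorTensorComm ℂ A A A A).toLinearMap =
      ((TensorProduct.lid ℂ A).toLinearMap ∘ₗ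
        TensorProduct.map (TensorProduct.lift signR)
          (LinearMap.mul' ℂ A ∘ₗ (TensorProduct.comm ℂ A A).toLinearMap) ∘ₗ
        (TensorProduct.tensorTensorTensorComm ℂ CZ2 A CZ2 A).toLinearMap) ∘ₗ
      TensorProduct.map
        ((TensorProduct.comm ℂ A CZ2).toLinearMap ∘ₗ LinearMap.lTensor A (π : A →ₗ[ℂ] CZ2))
        ((TensorProduct.comm ℂ A CZ2).toLinearMap ∘ₗ LinearMap.lTensor A (π : A →ₗ[ℂ] CZ2)) :=
    TensorProduct.ext_fourfold' fun x y z w => by simp [← hπ.pullback]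
  have h₁ := LinearMap.congr_fun e₁ (Coalgebra.comul a ⊗ₜ[ℂ] Coalgebra.comul b)
  have h₂ := LinearMap.congr_fun e₂ (Coalgebra.comul a ⊗ₜ[ℂ] Coalgebra.comul b)
  have hl := ha.left
  have hl' := hb.left
  have hr := ha.right
  have hr' := hb.right
  simp only [leftCoact, rightCoact, LinearMap.comp_apply, LinearEquiv.coe_coe] at hl hl' hr hr'
  simp only [LinearMap.comp_apply, LinearEquiv.coe_coe, TensorProduct.map_tmul, hl, hl', hr, hr',
    TensorProduct.tensorTensorTensorComm_tmul, TensorProduct.lift.tmul, LinearMap.mul'_apply,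
    TensorProduct.lid_tmul, TensorProduct.comm_tmul, signR_grp] at h₁ h₂
  rw [← h₁, ← h₂]
  exact h

/-- The part `S'` of the antipode that swaps bidegrees is already a left convolution inverse of the
identity, so it is the whole antipode. -/
theorem IsHomog.antipode (ha : IsHomog π i j a) :
    IsHomog π j i (HopfAlgebra.antipode ℂ a) := by
  let S' : A →ₗ[ℂ] A := ∑ i, ∑ j, biProj π j i ∘ₗ HopfAlgebra.antipode ℂ ∘ₗ biProj π i j
  have hS' : ∀ {i j : ZMod 2} {x : A}, IsHomog π i j x →
      S' x = biProj π j i (HopfAlgebra.antipode ℂ x) := fun {i j x} hx => by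
    simp only [S', LinearMap.sum_apply, LinearMap.comp_apply, hx.biProj_eq]
    rw [Finset.sum_eq_single i, Finset.sum_eq_single j]
    · simp
    · intro b _ hb; simp [hb.symm]
    · simp
    · intro b _ hb; simp [hb.symm]
    · simp
  have hmul : ∀ {i j k l : ZMod 2} {x y : A}, IsHomog π k l y →
      biProj π i j x * y = biProj π (i + k) (j + l) (x * y) := fun {i j k l x y} hy => by
    conv_rhs => rw [← sum_biProj π x]
    simp only [Finset.sum_mul, map_sum, ((isHomog_biProj π _ _ x).mul hy).biProj_eq,
      add_left_inj]
    rw [Finset.sum_eq_single i, Finset.sum_eq_single j]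
    · simp
    · intro b _ hb; simp [hb]
    · simp
    · intro b _ hb; simp [hb]
    · simp
  -- For `x` of bidegree `(i, j)` the sum `S'(x₁) x₂` is the component of `S(x₁) x₂ = ε(x) 1` in
  -- bidegree `(0, i + j)`. For `i = j` this is everything; otherwise `ε(x) = 0`.
  have hinv : LinearMap.mul' ℂ A ∘ₗ LinearMap.rTensor A S' ∘ₗ Coalgebra.comul =
      Algebra.linearMap ℂ A ∘ₗ Coalgebra.counit := by
    refine ext_homog (π := π) fun i j x hx => ?_
    have h := hx.comul_congr (f := LinearMap.mul' ℂ A ∘ₗ LinearMap.rTensor A S')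
      (g := biProj π 0 (i + j) ∘ₗ LinearMap.mul' ℂ A ∘ₗ
        LinearMap.rTensor A (HopfAlgebra.antipode ℂ)) fun m y z hy hz => by
          simp [hS' hy, hmul hz, CharTwo.add_self_eq_zero]
    refine h.trans ?_
    simp only [LinearMap.comp_apply, HopfAlgebra.mul_antipode_rTensor_comul_apply,
      Algebra.linearMap_apply, Algebra.algebraMap_eq_smul_one, map_smul,
      (IsHomog.one π).biProj_eq]
    by_cases hij : i = j
    · simp [hij, CharTwo.add_self_eq_zero]
    · simp [hx.counit_eq_zero hij]
  have h₁ : WithConv.toConv S' * WithConv.toConv (LinearMap.id : A →ₗ[ℂ] A) = 1 := by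
    ext x
    exact LinearMap.congr_fun hinv x
  have h₂ := left_inv_eq_right_inv h₁ (LinearMap.id_mul_antipode (R := ℂ) (C := A))
  have h₃ : S' = HopfAlgebra.antipode ℂ := congrArg WithConv.ofConv h₂
  rw [← h₃, hS' ha]
  exact isHomog_biProj π j i _

end QuasiCommutative

/-! ## Structure maps on homogeneous tensors -/

section Tensors

variable {V W X Y V' W' : Type*}
  [AddCommGroup V] [Module ℂ V] [AddCommGroup W] [Module ℂ W]
  [AddCommGroup X] [Module ℂ X] [AddCommGroup Y] [Module ℂ Y]
  [AddCommGroup V'] [Module ℂ V'] [AddCommGroup W'] [Module ℂ W']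

theorem mid_tmul {f : W ⊗[ℂ] X →ₗ[ℂ] V' ⊗[ℂ] W'} {w : W} {x : X} {c : ℂ} {p : V'} {q : W'}
    (h : f (w ⊗ₜ x) = c • p ⊗ₜ[ℂ] q) (v : V) (y : Y) :
    mid f ((v ⊗ₜ w) ⊗ₜ (x ⊗ₜ y)) = c • ((v ⊗ₜ[ℂ] p) ⊗ₜ[ℂ] (q ⊗ₜ[ℂ] y)) := by
  simp [mid, h, TensorProduct.smul_tmul']

theorem tensorCoaction_tmul {δV : V →ₗ[ℂ] CZ2 ⊗[ℂ] V} {δW : W →ₗ[ℂ] CZ2 ⊗[ℂ] W} {i k : ZMod 2}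
    {v : V} {w : W} (hv : δV v = grp i ⊗ₜ v) (hw : δW w = grp k ⊗ₜ w) :
    tensorCoaction δV δW (v ⊗ₜ w) = grp (i + k) ⊗ₜ (v ⊗ₜ[ℂ] w) := by
  simp [tensorCoaction, hv, hw, grp_mul]

theorem braiding_tmul {δV : V →ₗ[ℂ] CZ2 ⊗[ℂ] V} {δW : W →ₗ[ℂ] CZ2 ⊗[ℂ] W} {i k : ZMod 2}
    {v : V} {w : W} (hv : δV v = grp i ⊗ₜ v) (hw : δW w = grp k ⊗ₜ w) :
    braiding signR δV δW (v ⊗ₜ w) = parity (i * k) • w ⊗ₜ[ℂ] v := by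
  simp [braiding, hv, hw, signR_grp, mul_comm]

variable {B : Type*} [Ring B] [Algebra ℂ B] {δ : B →ₗ[ℂ] CZ2 ⊗[ℂ] B}
  {i k l : ZMod 2} {b c : B}

theorem bosCross_tmul (k : ZMod 2) (hc : δ c = grp i ⊗ₜ c) :
    bosCross signR δ (grp k ⊗ₜ c) = parity (k * i) • c ⊗ₜ[ℂ] grp k :=
  braiding_tmul (comul_grp k) hc

theorem bosCocross_tmul (k : ZMod 2) (hb : δ b = grp i ⊗ₜ b) :
    bosCocross δ (b ⊗ₜ grp k) = grp (i + k) ⊗ₜ[ℂ] b := by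
  simp [bosCocross, hb, grp_mul]

theorem bosMul_tmul (b : B) (k l : ZMod 2) (hc : δ c = grp i ⊗ₜ c) :
    bosMul signR δ ((b ⊗ₜ grp k) ⊗ₜ (c ⊗ₜ grp l)) =
      parity (k * i) • (b * c) ⊗ₜ[ℂ] grp (k + l) := by
  rw [bosMul, LinearMap.comp_apply, mid_tmul (bosCross_tmul k hc)]
  simp [grp_mul]

/-- `x ⊗ y ↦ (x ⊗ y₍₁₎ gᵏ) ⊗ (y₍₂₎ ⊗ gᵏ)`. -/
def bosComulAux (δ : B →ₗ[ℂ] CZ2 ⊗[ℂ] B) (k : ZMod 2) :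
    B ⊗[ℂ] B →ₗ[ℂ] (B ⊗[ℂ] CZ2) ⊗[ℂ] (B ⊗[ℂ] CZ2) :=
  mid (bosCocross δ) ∘ₗ (TensorProduct.mk ℂ _ _).flip (grp k ⊗ₜ grp k)

theorem bosComulAux_tmul (b : B) (k : ZMod 2) (hc : δ c = grp i ⊗ₜ c) :
    bosComulAux δ k (b ⊗ₜ c) = (b ⊗ₜ[ℂ] grp (i + k)) ⊗ₜ[ℂ] (c ⊗ₜ[ℂ] grp k) := by
  have := mid_tmul (c := 1) (by rw [bosCocross_tmul k hc, one_smul]) b (grp k)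
  simpa [bosComulAux] using this

variable [Coalgebra ℂ B]

theorem bosComul_tmul_grp (b : B) (k : ZMod 2) :
    bosComul δ (b ⊗ₜ grp k) = bosComulAux δ k (Coalgebra.comul b) := by
  simp [bosComul, bosComulAux, comul_grp]

theorem bosProj_tmul (b : B) (h : CZ2) :
    bosProj CZ2 B (b ⊗ₜ h) = Coalgebra.counit (R := ℂ) b • h := by
  simp [bosProj]

theorem bosCounit_tmul_grp (b : B) (k : ZMod 2) :
    bosCounit CZ2 B (b ⊗ₜ grp k) = Coalgebra.counit (R := ℂ) b := by
  simp [bosCounit, bosProj_tmul, counit_grp]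

end Tensors

/-! ## The transmutation of a Hopf algebra over `C'(ℤ₂)` -/

section TwistedProduct

variable {A : Type*} [Ring A] [HopfAlgebra ℂ A] (π : A →ₐc[ℂ] CZ2)

/-- The product `a ∘ b = (-1)^(j (k + l)) a b` for `a` of bidegree `(i, j)` and `b` of bidegree
`(k, l)`. -/
def twistedMul : A →ₗ[ℂ] A →ₗ[ℂ] A :=
  ∑ j, ∑ k, ∑ l, parity (j * (k + l)) •
    (LinearMap.mul ℂ A).compl₁₂ (rightProj π j) (biProj π k l)

variable {π} {i j k l : ZMod 2} {a b : A}

theorem twistedMul_eq (ha : IsHomog π i j a) (hb : IsHomog π k l b) :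
    twistedMul π a b = parity (j * (k + l)) • (a * b) := by
  simp only [twistedMul, LinearMap.sum_apply, LinearMap.smul_apply, LinearMap.compl₁₂_apply,
    ha.rightProj_eq, hb.biProj_eq]
  rw [Finset.sum_eq_single j, Finset.sum_eq_single k, Finset.sum_eq_single l]
  · simp
  · intro b _ hb; simp [hb.symm]
  · simp
  · intro b _ hb; simp [hb.symm]
  · simp
  · intro b _ hb; simp [hb.symm]
  · simp

/-- The exponent is biadditive in the right degree of the first factor and the total degree of the
second, and both degrees add under multiplication; such a twist preserves associativity. -/
theorem twistedMul_assoc (a b c : A) :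
    twistedMul π (twistedMul π a b) c = twistedMul π a (twistedMul π b c) := by
  have : (twistedMul π).compr₂ (twistedMul π) =
      (LinearMap.lcomp ℂ _ (twistedMul π) ∘ₗ LinearMap.llcomp ℂ A A A) ∘ₗ twistedMul π := by
    refine ext_homog (π := π) fun i j a ha => ext_homog (π := π) fun k l b hb =>
      ext_homog (π := π) fun m n c hc => ?_
    simp only [LinearMap.compr₂_apply, LinearMap.comp_apply, LinearMap.lcomp_apply,
      LinearMap.llcomp_apply, twistedMul_eq ha hb, twistedMul_eq hb hc, map_smul,
      LinearMap.smul_apply, twistedMul_eq (ha.mul hb) hc, twistedMul_eq ha (hb.mul hc),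
      smul_smul, ← parity_add, mul_assoc]
    congr 2
    ring
  exact LinearMap.congr_fun (LinearMap.congr_fun₂ this a b) c

theorem one_twistedMul (a : A) : twistedMul π 1 a = a := by
  refine LinearMap.congr_fun (g := LinearMap.id) (ext_homog (π := π) fun i j a ha => ?_) a
  simp [twistedMul_eq (.one π) ha, parity_zero]

theorem twistedMul_one (a : A) : twistedMul π a 1 = a := by
  refine LinearMap.congr_fun (f := (twistedMul π).flip 1) (g := LinearMap.id)
    (ext_homog (π := π) fun i j a ha => ?_) a
  simp [twistedMul_eq ha (.one π), parity_zero]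

end TwistedProduct

/-- The coalgebra `A` with the twisted product: the `ℤ₂`-graded Hopf algebra `B` for which `A` is
the spin-statistics reduction of `B ⋊ C'(ℤ₂)`. -/
def Transmutation {A : Type*} [Ring A] [HopfAlgebra ℂ A] (_ : A →ₐc[ℂ] CZ2) : Type _ := A

namespace Transmutation

variable {A : Type*} [Ring A] [HopfAlgebra ℂ A] (π : A →ₐc[ℂ] CZ2)

/-- The additive group of `A`. -/
abbrev addCommGroup : AddCommGroup (Transmutation π) := inferInstanceAs (AddCommGroup A)

instance : Ring (Transmutation π) where
  __ := addCommGroup π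
  mul := fun a b : A => twistedMul π a b
  one := (1 : A)
  left_distrib := fun a b c : A => map_add (twistedMul π a) b c
  right_distrib := fun a b c : A => LinearMap.map_add₂ (twistedMul π) a b c
  zero_mul := fun a : A => LinearMap.map_zero₂ (twistedMul π) a
  mul_zero := fun a : A => map_zero (twistedMul π a)
  mul_assoc := twistedMul_assoc (π := π)
  one_mul := one_twistedMul (π := π)
  mul_one := twistedMul_one (π := π)

instance : Algebra ℂ (Transmutation π) :=
  letI : Module ℂ (Transmutation π) := inferInstanceAs (Module ℂ A)
  Algebra.ofModule (fun (c : ℂ) (a b : A) => LinearMap.map_smul₂ (twistedMul π) c a b)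
    (fun (c : ℂ) (a b : A) => map_smul (twistedMul π a) c b)

/-- The identity map from `A` to its transmutation. -/
def of : A ≃ₗ[ℂ] Transmutation π where
  toFun a := a
  invFun a := a
  map_add' _ _ := rfl
  map_smul' _ _ := rfl
  left_inv _ := rfl
  right_inv _ := rfl

theorem of_mul_of (a b : A) : of π a * of π b = of π (twistedMul π a b) := rfl

theorem of_one : of π 1 = 1 := rfl

instance : Coalgebra ℂ (Transmutation π) := inferInstanceAs (Coalgebra ℂ A)

theorem comul_of (a : A) : Coalgebra.comul (R := ℂ) (of π a) =
    TensorProduct.map (of π).toLinearMap (of π).toLinearMap (Coalgebra.comul a) := by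
  change _ = TensorProduct.map LinearMap.id LinearMap.id _
  rw [TensorProduct.map_id]
  rfl

theorem counit_of (a : A) : Coalgebra.counit (R := ℂ) (of π a) = Coalgebra.counit a := rfl

variable {π} in
theorem ext_of {M : Type*} [AddCommMonoid M] [Module ℂ M] {f g : Transmutation π →ₗ[ℂ] M}
    (h : ∀ i j a, IsHomog π i j a → f (of π a) = g (of π a)) : f = g := by
  have : f ∘ₗ (of π).toLinearMap = g ∘ₗ (of π).toLinearMap := ext_homog h
  exact LinearMap.ext fun a => LinearMap.congr_fun this a

/-- The coaction of `C(ℤ₂)`: elements of bidegree `(i, j)` have degree `i + j`. -/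
def coact : Transmutation π →ₗ[ℂ] CZ2 ⊗[ℂ] Transmutation π :=
  ∑ i, ∑ j, TensorProduct.mk ℂ CZ2 (Transmutation π) (grp (i + j)) ∘ₗ (of π).toLinearMap ∘ₗ
    biProj π i j ∘ₗ (of π).symm.toLinearMap

/-- The antipode `(-1)^(i (i + j)) S a` on elements `a` of bidegree `(i, j)`. -/
def antipode : Transmutation π →ₗ[ℂ] Transmutation π :=
  ∑ i, ∑ j, parity (i * (i + j)) • (of π).toLinearMap ∘ₗ HopfAlgebra.antipode ℂ ∘ₗ
    biProj π i j ∘ₗ (of π).symm.toLinearMap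

variable {π} {i j k l : ZMod 2} {a b : A}

theorem coact_of (ha : IsHomog π i j a) : coact π (of π a) = grp (i + j) ⊗ₜ of π a := by
  simp only [coact, LinearMap.sum_apply, LinearMap.comp_apply, LinearEquiv.coe_coe,
    LinearEquiv.symm_apply_apply, ha.biProj_eq]
  rw [Finset.sum_eq_single i, Finset.sum_eq_single j]
  · simp
  · intro b _ hb; simp [hb.symm]
  · simp
  · intro b _ hb; simp [hb.symm]
  · simp

theorem antipode_of (ha : IsHomog π i j a) :
    antipode π (of π a) = parity (i * (i + j)) • of π (HopfAlgebra.antipode ℂ a) := by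
  simp only [antipode, LinearMap.sum_apply, LinearMap.comp_apply, LinearMap.smul_apply,
    LinearEquiv.coe_coe, LinearEquiv.symm_apply_apply, ha.biProj_eq]
  rw [Finset.sum_eq_single i, Finset.sum_eq_single j]
  · simp
  · intro b _ hb; simp [hb.symm]
  · simp
  · intro b _ hb; simp [hb.symm]
  · simp

theorem of_mul_of_eq (ha : IsHomog π i j a) (hb : IsHomog π k l b) :
    of π a * of π b = parity (j * (k + l)) • of π (a * b) := by
  rw [of_mul_of, twistedMul_eq ha hb, map_smul]

/-- The inner degree `m` occurs in both legs and cancels modulo 2. -/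
theorem coact_comul (ha : IsHomog π i j a) :
    tensorCoaction (coact π) (coact π) (Coalgebra.comul (of π a)) =
      grp (i + j) ⊗ₜ Coalgebra.comul (of π a) := by
  rw [comul_of]
  refine ha.comul_congr (f := tensorCoaction (coact π) (coact π) ∘ₗ TensorProduct.map _ _)
    (g := TensorProduct.mk ℂ _ _ (grp (i + j)) ∘ₗ TensorProduct.map _ _) fun m x y hx hy => ?_
  simp only [LinearMap.comp_apply, TensorProduct.map_tmul, LinearEquiv.coe_coe,
    tensorCoaction_tmul (coact_of hx) (coact_of hy), TensorProduct.mk_apply]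
  have key : ∀ i j m : ZMod 2, i + m + (m + j) = i + j := by decide
  rw [key]

/-- With `m`, `n` the inner degrees of `Δ a`, `Δ b`, the braiding contributes `(m + j)(k + n)` and
the two twisted products `m(k + n)` and `j(n + l)`. Modulo 2 the inner degrees drop out and `j(k +
l)` remains, the exponent of the twisted product itself. -/
theorem comul_mul (ha : IsHomog π i j a) (hb : IsHomog π k l b) :
    Coalgebra.comul (R := ℂ) (of π a * of π b) =
      TensorProduct.map (LinearMap.mul' ℂ _) (LinearMap.mul' ℂ _)
        (mid (braiding signR (coact π) (coact π))
          (Coalgebra.comul (of π a) ⊗ₜ Coalgebra.comul (of π b))) := by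
  let T : A ⊗[ℂ] A →ₗ[ℂ] Transmutation π ⊗[ℂ] Transmutation π :=
    TensorProduct.map (of π).toLinearMap (of π).toLinearMap
  let G := TensorProduct.map (LinearMap.mul' ℂ (Transmutation π)) (LinearMap.mul' ℂ _) ∘ₗ
    mid (braiding signR (coact π) (coact π))
  rw [of_mul_of_eq ha hb, map_smul, comul_of, comul_of, comul_of, Bialgebra.comul_mul]
  refine ha.comul_congr
    (f := parity (j * (k + l)) • T ∘ₗ (LinearMap.mul ℂ _).flip (Coalgebra.comul b))
    (g := G ∘ₗ (TensorProduct.mk ℂ _ _).flip (T (Coalgebra.comul b)) ∘ₗ T) fun m x y hx hy => ?_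
  refine hb.comul_congr
    (f := parity (j * (k + l)) • T ∘ₗ LinearMap.mul ℂ _ (x ⊗ₜ y))
    (g := G ∘ₗ TensorProduct.mk ℂ _ _ (T (x ⊗ₜ y)) ∘ₗ T) fun n z w hz hw => ?_
  simp only [T, G, LinearMap.comp_apply, LinearMap.smul_apply, LinearMap.mul_apply',
    Algebra.TensorProduct.tmul_mul_tmul, TensorProduct.map_tmul, LinearEquiv.coe_coe,
    TensorProduct.mk_apply, mid_tmul (braiding_tmul (coact_of hy) (coact_of hz)), map_smul,
    LinearMap.mul'_apply, of_mul_of_eq hx hz, of_mul_of_eq hy hw, TensorProduct.smul_tmul_smul,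
    smul_smul, ← parity_add]
  have key : ∀ j k l m n : ZMod 2,
      j * (k + l) = (m + j) * (k + n) + (m * (k + n) + j * (n + l)) := by decide
  rw [key j k l m n]

variable (π) in
theorem isCoaction_coact : IsCoaction (coact π) where
  coassoc := ext_of fun i j a ha => by simp [coact_of ha, comul_grp]
  counit := ext_of fun i j a ha => by simp [coact_of ha, counit_grp]

variable (π) in
/-- The transmutation of `A` as a Hopf algebra in the category of `C'(ℤ₂)`-comodules. -/
def hopf : BraidedHopfAlgebra signR (Transmutation π) where
  coact := coact π
  antipode := antipode π
  isCoaction := isCoaction_coact π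
  coact_one := by rw [← of_one, coact_of (.one π), add_zero, grp_zero]
  coact_mul := by
    refine TensorProduct.ext (ext_of fun i j a ha => ext_of fun k l b hb => ?_)
    simp only [LinearMap.compr₂ₛₗ_apply, TensorProduct.mk_apply, LinearMap.comp_apply,
      LinearMap.mul'_apply, tensorCoaction_tmul (coact_of ha) (coact_of hb),
      LinearMap.lTensor_tmul, of_mul_of_eq ha hb, map_smul, coact_of (ha.mul hb),
      TensorProduct.tmul_smul]
    congr 3
    ring
  coact_counit := LinearMap.congr_fun
    (f := LinearMap.lTensor CZ2 Coalgebra.counit ∘ₗ coact π)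
    (g := TensorProduct.mk ℂ CZ2 ℂ 1 ∘ₗ Coalgebra.counit) (ext_of fun i j a ha => by
      by_cases hij : i = j
      · simp [coact_of ha, hij, CharTwo.add_self_eq_zero, grp_zero]
      · simp [coact_of ha, counit_of, ha.counit_eq_zero hij])
  coact_comul := ext_of fun i j a ha => by
    simp only [LinearMap.comp_apply, coact_comul ha, coact_of ha, LinearMap.lTensor_tmul]
  coact_antipode := ext_of fun i j a ha => by
    simp only [LinearMap.comp_apply, coact_of ha, LinearMap.lTensor_tmul, antipode_of ha, map_smul,
      coact_of ha.antipode, TensorProduct.tmul_smul, add_comm]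
  counit_one := by rw [← of_one, counit_of, Bialgebra.counit_one]
  counit_mul a b := by
    have : (LinearMap.mul ℂ (Transmutation π)).compr₂ Coalgebra.counit =
        (LinearMap.mul ℂ ℂ).compl₁₂ Coalgebra.counit Coalgebra.counit := by
      refine ext_of fun i j a ha => ext_of fun k l b hb => ?_
      -- For `k = l` the twist is trivial; for `k ≠ l` both sides contain the factor `ε(b) = 0`.
      by_cases hkl : k = l
      · simp [of_mul_of_eq ha hb, counit_of, hkl, CharTwo.add_self_eq_zero, parity_zero]
      · simp [of_mul_of_eq ha hb, counit_of, hb.counit_eq_zero hkl]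
    exact LinearMap.congr_fun₂ this a b
  comul_one := by
    rw [← of_one, comul_of, Bialgebra.comul_one]
    rfl
  comul_mul := TensorProduct.ext (ext_of fun i j a ha => ext_of fun k l b hb => comul_mul ha hb)
  antipode_left := ext_of fun i j a ha => by
    have h := ha.comul_congr
      (f := LinearMap.mul' ℂ _ ∘ₗ LinearMap.rTensor _ (antipode π) ∘ₗ
        TensorProduct.map (of π).toLinearMap (of π).toLinearMap)
      (g := parity (i * (i + j)) • (of π).toLinearMap ∘ₗ LinearMap.mul' ℂ A ∘ₗ
        LinearMap.rTensor A (HopfAlgebra.antipode ℂ)) fun m x y hx hy => by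
          simp only [LinearMap.comp_apply, TensorProduct.map_tmul, LinearEquiv.coe_coe,
            LinearMap.rTensor_tmul, antipode_of hx, LinearMap.mul'_apply, smul_mul_assoc,
            of_mul_of_eq hx.antipode hy, LinearMap.smul_apply, smul_smul, ← parity_add]
          -- The total sign does not depend on the inner degree `m`, so it leaves the sum; it equals
          -- `1` for `i = j`, the only case with a nonzero counit.
          have key : ∀ i j m : ZMod 2, i * (i + m) + i * (m + j) = i * (i + j) := by decide
          rw [key]
    simp only [LinearMap.comp_apply, comul_of] at h ⊢
    refine h.trans ?_
    simp only [LinearMap.smul_apply, LinearMap.comp_apply,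
      HopfAlgebra.mul_antipode_rTensor_comul_apply, counit_of, Algebra.linearMap_apply,
      Algebra.algebraMap_eq_smul_one, map_smul, LinearEquiv.coe_coe, of_one]
    by_cases hij : i = j
    · simp [hij, CharTwo.add_self_eq_zero, parity_zero]
    · simp [ha.counit_eq_zero hij]
  antipode_right := ext_of fun i j a ha => by
    have h := ha.comul_congr
      (f := LinearMap.mul' ℂ _ ∘ₗ LinearMap.lTensor _ (antipode π) ∘ₗ
        TensorProduct.map (of π).toLinearMap (of π).toLinearMap)
      (g := (of π).toLinearMap ∘ₗ LinearMap.mul' ℂ A ∘ₗ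
        LinearMap.lTensor A (HopfAlgebra.antipode ℂ)) fun m x y hx hy => by
          simp only [LinearMap.comp_apply, TensorProduct.map_tmul, LinearEquiv.coe_coe,
            LinearMap.lTensor_tmul, antipode_of hy, LinearMap.mul'_apply, mul_smul_comm,
            of_mul_of_eq hx hy.antipode, smul_smul]
          -- Here the sign in the antipode cancels the twist term by term.
          rw [add_comm j m, parity_mul_self, one_smul]
    simp only [LinearMap.comp_apply, comul_of] at h ⊢
    refine h.trans ?_
    simp only [HopfAlgebra.mul_antipode_lTensor_comul_apply, counit_of, Algebra.linearMap_apply,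
      Algebra.algebraMap_eq_smul_one, map_smul, LinearEquiv.coe_coe, of_one]

/-- Quasi-commutativity of `A` turns `ba` into `(-1)^(ik + jl) ab`. Together with the braiding sign
`(i + j)(k + l)` and the twist `l(i + j)` this leaves `j(k + l)` modulo 2. -/
theorem braided_comm {RA : A →ₗ[ℂ] A →ₗ[ℂ] ℂ} (hRA : IsCoquasitriangular RA)
    (hπ : IsQuantumGroupSurjection RA signR π) :
    LinearMap.mul' ℂ (Transmutation π) ∘ₗ braiding signR (coact π) (coact π) =
      LinearMap.mul' ℂ _ := by
  refine TensorProduct.ext (ext_of fun i j a ha => ext_of fun k l b hb => ?_)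
  have h : b * a = parity (i * k + j * l) • (a * b) := by
    rw [add_comm, parity_add, mul_smul, ha.mul_comm hb hRA hπ, smul_smul, parity_mul_self, one_smul]
  simp only [LinearMap.compr₂ₛₗ_apply, TensorProduct.mk_apply, LinearMap.comp_apply,
    LinearMap.mul'_apply, braiding_tmul (coact_of ha) (coact_of hb), map_smul,
    of_mul_of_eq ha hb, of_mul_of_eq hb ha, h, smul_smul, ← parity_add]
  have key : ∀ i j k l : ZMod 2,
      (i + j) * (k + l) + (l * (i + j) + (i * k + j * l)) = j * (k + l) := by decide
  rw [key]

variable (π) in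
/-- The map `π`, as a homomorphism from the transmutation of `A` to `C(ℤ₂)`. -/
def proj : Transmutation π →ₐc[ℂ] CZ2 where
  toLinearMap := (π : A →ₗ[ℂ] CZ2) ∘ₗ (of π).symm.toLinearMap
  counit_comp := CoalgHomClass.counit_comp π
  map_comp_comul := CoalgHomClass.map_comp_comul π
  map_one' := map_one π
  map_mul' a b := by
    have : (LinearMap.mul ℂ (Transmutation π)).compr₂
          ((π : A →ₗ[ℂ] CZ2) ∘ₗ (of π).symm.toLinearMap) =
        (LinearMap.mul ℂ CZ2).compl₁₂ ((π : A →ₗ[ℂ] CZ2) ∘ₗ (of π).symm.toLinearMap)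
          ((π : A →ₗ[ℂ] CZ2) ∘ₗ (of π).symm.toLinearMap) := by
      refine ext_of fun i j a ha => ext_of fun k l b hb => ?_
      by_cases hkl : k = l
      · simp [of_mul_of_eq ha hb, hkl, CharTwo.add_self_eq_zero, parity_zero]
      · simp [of_mul_of_eq ha hb, hb.map_left, hb.counit_eq_zero hkl]
    exact LinearMap.congr_fun₂ this a b

theorem proj_of (a : A) : proj π (of π a) = π a := rfl

end Transmutation

/-! ### The embedding of `A` into the bosonization of its transmutation -/

namespace Transmutation

variable {A : Type*} [Ring A] [HopfAlgebra ℂ A] (π : A →ₐc[ℂ] CZ2)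

/-- The embedding `a ↦ a₁ ⊗ π(a₂)` of `A` into `B ⋊ C'(ℤ₂)`. -/
def embed : A →ₗ[ℂ] Transmutation π ⊗[ℂ] CZ2 :=
  TensorProduct.map (of π).toLinearMap (π : A →ₗ[ℂ] CZ2) ∘ₗ Coalgebra.comul

variable {π} {i j k l : ZMod 2} {a b : A}

theorem embed_eq (ha : IsHomog π i j a) : embed π a = of π a ⊗ₜ grp j := by
  have e : TensorProduct.map (of π).toLinearMap (π : A →ₗ[ℂ] CZ2) =
      ((TensorProduct.comm ℂ CZ2 (Transmutation π)).toLinearMap ∘ₗ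
        LinearMap.lTensor CZ2 (of π).toLinearMap) ∘ₗ (TensorProduct.comm ℂ A CZ2).toLinearMap ∘ₗ
        LinearMap.lTensor A (π : A →ₗ[ℂ] CZ2) := TensorProduct.ext' fun _ _ => rfl
  have h := LinearMap.congr_fun e (Coalgebra.comul a)
  refine h.trans ((congrArg ((TensorProduct.comm ℂ CZ2 (Transmutation π)).toLinearMap ∘ₗ
    LinearMap.lTensor CZ2 (of π).toLinearMap) ha.right).trans ?_)
  simp

/-- Reduces identities involving the bosonized coproduct to homogeneous legs. The shift `m + j` in
the exponent is the degree of the second leg `y`. -/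
theorem bosComul_of (ha : IsHomog π i j a) (k : ZMod 2) {M : Type*} [AddCommMonoid M] [Module ℂ M]
    (F : (Transmutation π ⊗[ℂ] CZ2) ⊗[ℂ] (Transmutation π ⊗[ℂ] CZ2) →ₗ[ℂ] M)
    (G : A ⊗[ℂ] A →ₗ[ℂ] M)
    (h : ∀ m x y, IsHomog π i m x → IsHomog π m j y →
      F ((of π x ⊗ₜ grp (m + j + k)) ⊗ₜ (of π y ⊗ₜ grp k)) = G (x ⊗ₜ y)) :
    F (bosComul (coact π) (of π a ⊗ₜ grp k)) = G (Coalgebra.comul a) := by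
  rw [bosComul_tmul_grp, comul_of]
  refine ha.comul_congr (f := F ∘ₗ bosComulAux (coact π) k ∘ₗ
    TensorProduct.map (of π).toLinearMap (of π).toLinearMap) (g := G) fun m x y hx hy => ?_
  simp only [LinearMap.comp_apply, TensorProduct.map_tmul, LinearEquiv.coe_coe,
    bosComulAux_tmul _ k (coact_of hy)]
  exact h m x y hx hy

/-- For `k = j` the exponent `m + j + k` in the first leg is `m`, precisely the right degree of `x`.
-/
theorem bosComul_embed : bosComul (coact π) ∘ₗ embed π =
    TensorProduct.map (embed π) (embed π) ∘ₗ Coalgebra.comul := by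
  refine ext_homog (π := π) fun i j a ha => ?_
  rw [LinearMap.comp_apply, embed_eq ha]
  refine bosComul_of ha j LinearMap.id (TensorProduct.map (embed π) (embed π))
    fun m x y hx hy => ?_
  have key : ∀ j m : ZMod 2, m + j + j = m := by decide
  simp [embed_eq hx, embed_eq hy, key]

theorem bosProj_embed (a : A) : bosProj CZ2 _ (embed π a) = π a := by
  refine LinearMap.congr_fun (f := bosProj CZ2 _ ∘ₗ embed π) (g := (π : A →ₗ[ℂ] CZ2))
    (ext_homog (π := π) fun i j a ha => ?_) a
  simp [embed_eq ha, bosProj_tmul, counit_of, ha.map_right]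

theorem rTensor_proj_embed (a : A) :
    LinearMap.rTensor CZ2 (proj π : Transmutation π →ₗ[ℂ] CZ2) (embed π a) =
      Coalgebra.comul (π a) := by
  refine LinearMap.congr_fun (f := LinearMap.rTensor CZ2 _ ∘ₗ embed π)
    (g := Coalgebra.comul ∘ₗ (π : A →ₗ[ℂ] CZ2)) (ext_homog (π := π) fun i j a ha => ?_) a
  simp [embed_eq ha, proj_of, ha.map_right, comul_grp, TensorProduct.smul_tmul']

/-- The sign from moving `gʲ` past `b` is `(-1)^(j(k+l))`, the same as the twist, and the two
cancel. -/
theorem embed_mul (a b : A) :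
    embed π (a * b) = bosMul signR (coact π) (embed π a ⊗ₜ embed π b) := by
  have : (LinearMap.mul ℂ A).compr₂ (embed π) =
      ((TensorProduct.mk ℂ _ _).compl₁₂ (embed π) (embed π)).compr₂ (bosMul signR (coact π)) := by
    refine ext_homog (π := π) fun i j a ha => ext_homog (π := π) fun k l b hb => ?_
    simp [embed_eq ha, embed_eq hb, embed_eq (ha.mul hb), bosMul_tmul _ _ _ (coact_of hb),
      of_mul_of_eq ha hb, TensorProduct.smul_tmul', smul_smul, parity_mul_self]
  exact LinearMap.congr_fun₂ this a b

theorem embed_antipode : bosAntipode signR (coact π) (antipode π) ∘ₗ embed π =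
    embed π ∘ₗ HopfAlgebra.antipode ℂ := by
  refine ext_homog (π := π) fun i j a ha => ?_
  have key : ∀ i j : ZMod 2, i + j + j = i := by decide
  simp [bosAntipode, embed_eq ha, bosCocross_tmul j (coact_of ha), key, antipode_grp,
    antipode_of ha, bosCross_tmul i (coact_of ha.antipode), embed_eq ha.antipode, smul_smul,
    add_comm j i, parity_mul_self]

variable (π) in
/-- The map `a ⊗ gᵏ ↦ a ⊗ g^(j + k)` for `a` of right degree `j`. -/
def rightShift : A ⊗[ℂ] CZ2 →ₗ[ℂ] A ⊗[ℂ] CZ2 :=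
  ∑ j, TensorProduct.map (rightProj π j) (LinearMap.mulLeft ℂ (grp j))

theorem rightShift_tmul (ha : IsHomog π i j a) (k : ZMod 2) :
    rightShift π (a ⊗ₜ grp k) = a ⊗ₜ grp (j + k) := by
  simp only [rightShift, LinearMap.sum_apply, TensorProduct.map_tmul, ha.rightProj_eq,
    LinearMap.mulLeft_apply, grp_mul]
  rw [Finset.sum_eq_single j]
  · simp
  · intro b _ hb; simp [hb.symm]
  · simp

variable (π) in
theorem rightShift_involutive : Function.Involutive (rightShift π) := by
  refine LinearMap.congr_fun (f := rightShift π ∘ₗ rightShift π) (g := LinearMap.id)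
    (TensorProduct.ext (ext_homog (π := π) fun i j a ha => ext_grp fun k => ?_))
  have key : ∀ j k : ZMod 2, j + (j + k) = k := by decide
  simp [rightShift_tmul ha, key]

/-- Once `B` is identified with `A`, this multiplication map is `rightShift`, its own inverse
because `2j = 0`. -/
theorem bijective_bosMul_embed : Function.Bijective
    (bosMul signR (coact π) ∘ₗ
      TensorProduct.map (embed π) (TensorProduct.mk ℂ (Transmutation π) CZ2 1)) := by
  have e : bosMul signR (coact π) ∘ₗ
      TensorProduct.map (embed π) (TensorProduct.mk ℂ (Transmutation π) CZ2 1) =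
      (LinearEquiv.rTensor CZ2 (of π)).toLinearMap ∘ₗ rightShift π := by
    refine TensorProduct.ext (ext_homog (π := π) fun i j a ha => ext_grp fun k => ?_)
    have h : coact π 1 = grp 0 ⊗ₜ 1 := coact_of (.one π)
    simp [embed_eq ha, rightShift_tmul ha, bosMul_tmul _ _ _ h, parity_zero]
  rw [e]
  exact (LinearEquiv.rTensor CZ2 (of π)).bijective.comp (rightShift_involutive π).bijective

theorem embed_injective : Function.Injective (embed π) := by
  intro a b hab
  have h : ((TensorProduct.rid ℂ _).toLinearMap ∘ₗ
      LinearMap.lTensor (Transmutation π) Coalgebra.counit) ∘ₗ embed π = (of π).toLinearMap :=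
    ext_homog (π := π) fun i j a ha => by simp [embed_eq ha, counit_grp]
  have := congrArg ((TensorProduct.rid ℂ _).toLinearMap ∘ₗ
      LinearMap.lTensor (Transmutation π) Coalgebra.counit) hab
  exact (of π).injective
    ((LinearMap.congr_fun h a).symm.trans (this.trans (LinearMap.congr_fun h b)))

end Transmutation

/-! ## The spin-statistics reduction -/

/-- The map `(id ⊗ σ̃ ⊗ id) Δ²` on `B ⋊ C'(ℤ₂)`. -/
def bosComulMid {B : Type*} [Ring B] [Algebra ℂ B] [Coalgebra ℂ B] (δ : B →ₗ[ℂ] CZ2 ⊗[ℂ] B)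
    (σ : B →ₗ[ℂ] CZ2) :
    B ⊗[ℂ] CZ2 →ₗ[ℂ] (B ⊗[ℂ] CZ2) ⊗[ℂ] ((CZ2 ⊗[ℂ] CZ2) ⊗[ℂ] (B ⊗[ℂ] CZ2)) :=
  TensorProduct.map LinearMap.id (TensorProduct.map (LinearMap.rTensor CZ2 σ) LinearMap.id) ∘ₗ
    LinearMap.lTensor (B ⊗[ℂ] CZ2) (bosComul δ) ∘ₗ bosComul δ

/-- The functional on `C(ℤ₂) ⊗ C(ℤ₂)` that vanishes on `gⁱ ⊗ gⁱ` and is `1` on the other tensors of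
group-like elements. -/
def offDiagonal : CZ2 ⊗[ℂ] CZ2 →ₗ[ℂ] ℂ :=
  TensorProduct.lift (∑ i, (LinearMap.mul ℂ ℂ).compl₁₂ (grpCoord i) (grpCoord (i + 1)))

theorem offDiagonal_grp (i k : ZMod 2) :
    offDiagonal (grp i ⊗ₜ grp k) = if i = k then 0 else 1 := by
  simp only [offDiagonal, TensorProduct.lift.tmul, LinearMap.sum_apply, LinearMap.compl₁₂_apply,
    LinearMap.mul_apply', grpCoord_grp]
  rw [Finset.sum_eq_single i]
  · have key : ∀ i k : ZMod 2, k = i + 1 ↔ i ≠ k := by decide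
    simp [key]
  · intro b _ hb; simp [hb.symm]
  · simp

theorem offDiagonal_comul (h : CZ2) : offDiagonal (Coalgebra.comul h) = 0 := by
  refine LinearMap.congr_fun (f := offDiagonal ∘ₗ Coalgebra.comul) (g := 0)
    (ext_grp fun i => ?_) h
  simp [comul_grp, offDiagonal_grp]

namespace Transmutation

variable {A : Type*} [Ring A] [HopfAlgebra ℂ A] {π : A →ₐc[ℂ] CZ2} {i j k l : ZMod 2} {a b : A}

variable (π) in
/-- `id ⊗ q ⊗ ε`, with `q` the functional `offDiagonal`. -/
def offDiagonalMid : (Transmutation π ⊗[ℂ] CZ2) ⊗[ℂ]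
    ((CZ2 ⊗[ℂ] CZ2) ⊗[ℂ] (Transmutation π ⊗[ℂ] CZ2)) →ₗ[ℂ] Transmutation π ⊗[ℂ] CZ2 :=
  (TensorProduct.rid ℂ _).toLinearMap ∘ₗ LinearMap.lTensor _ (LinearMap.mul' ℂ ℂ ∘ₗ
    TensorProduct.map offDiagonal (bosCounit CZ2 (Transmutation π)))

/-- After `ε` removes the last leg, the functional acts on the second leg `y ⊗ gᵏ` of `Δ(a ⊗ gᵏ)`.
There `σ̃` gives `ε(y) gʲ ⊗ gᵏ`, which requires `m = j` and is off the diagonal exactly for `j ≠ k`;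
the counit axiom then restores `a`. -/
theorem offDiagonalMid_bosComulMid (ha : IsHomog π i j a) (k : ZMod 2) :
    offDiagonalMid π (bosComulMid (coact π) (proj π : Transmutation π →ₗ[ℂ] CZ2)
      (of π a ⊗ₜ grp k)) = if j = k then 0 else of π a ⊗ₜ grp k := by
  let τ : Transmutation π ⊗[ℂ] CZ2 →ₗ[ℂ] ℂ :=
    offDiagonal ∘ₗ LinearMap.rTensor CZ2 (proj π : Transmutation π →ₗ[ℂ] CZ2)
  -- The counit axiom of the bosonization on its right leg, seen through `τ`.
  have hτ : (LinearMap.mul' ℂ ℂ ∘ₗ TensorProduct.map τ (bosCounit CZ2 (Transmutation π))) ∘ₗ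
      bosComul (coact π) = τ := by
    refine TensorProduct.ext (ext_of fun i j x hx => ext_grp fun k => ?_)
    change (LinearMap.mul' ℂ ℂ ∘ₗ TensorProduct.map τ (bosCounit CZ2 (Transmutation π)))
      (bosComul (coact π) (of π x ⊗ₜ grp k)) = τ (of π x ⊗ₜ grp k)
    refine (bosComul_of hx k
      (LinearMap.mul' ℂ ℂ ∘ₗ TensorProduct.map τ (bosCounit CZ2 (Transmutation π)))
      (τ ∘ₗ (TensorProduct.mk ℂ _ _).flip (grp k) ∘ₗ (of π).toLinearMap ∘ₗ
        (TensorProduct.rid ℂ A).toLinearMap ∘ₗ LinearMap.lTensor A Coalgebra.counit)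
      fun m y z hy hz => ?_).trans ?_
    · have key : ∀ j k : ZMod 2, j + j + k = k := by decide
      by_cases hm : m = j
      · simp [hm, key, bosCounit_tmul_grp, counit_of, mul_comm]
      · simp [bosCounit_tmul_grp, counit_of, hz.counit_eq_zero hm]
    · simp
  have e : offDiagonalMid π ∘ₗ bosComulMid (coact π) (proj π : Transmutation π →ₗ[ℂ] CZ2) =
      (TensorProduct.rid ℂ _).toLinearMap ∘ₗ LinearMap.lTensor _ τ ∘ₗ bosComul (coact π) := by
    have e' : offDiagonalMid π ∘ₗ
        TensorProduct.map LinearMap.id (TensorProduct.map (LinearMap.rTensor CZ2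
          (proj π : Transmutation π →ₗ[ℂ] CZ2)) LinearMap.id) =
        (TensorProduct.rid ℂ _).toLinearMap ∘ₗ LinearMap.lTensor _ (LinearMap.mul' ℂ ℂ ∘ₗ
          TensorProduct.map τ (bosCounit CZ2 (Transmutation π))) :=
      TensorProduct.ext' fun x t => by
        induction t with
        | zero => simp
        | tmul y z => rfl
        | add y z hy hz => rw [TensorProduct.tmul_add, map_add, map_add, hy, hz]
    rw [bosComulMid, ← LinearMap.comp_assoc, e']
    simp only [LinearMap.comp_assoc]
    congr 1
    rw [← LinearMap.comp_assoc, ← LinearMap.lTensor_comp, hτ]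
  refine (LinearMap.congr_fun e _).trans ((bosComul_of ha k
    ((TensorProduct.rid ℂ _).toLinearMap ∘ₗ LinearMap.lTensor _ τ)
    ((if j = k then 0 else 1 : ℂ) • (TensorProduct.mk ℂ _ _).flip (grp k) ∘ₗ (of π).toLinearMap ∘ₗ
        (TensorProduct.rid ℂ A).toLinearMap ∘ₗ LinearMap.lTensor A Coalgebra.counit)
      fun m y z hy hz => ?_).trans ?_)
  · have key : ∀ j k : ZMod 2, j + j + k = k := by decide
    by_cases hm : m = j
    · by_cases hjk : j = k
      · simp [τ, hm, hz.map_right, proj_of, offDiagonal_grp, hjk, ← TensorProduct.smul_tmul']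
      · simp [τ, hm, hz.map_right, proj_of, offDiagonal_grp, hjk, key, ← TensorProduct.smul_tmul']
    · by_cases hjk : j = k <;> simp [τ, hz.map_right, proj_of, hz.counit_eq_zero hm, hjk]
  · by_cases hjk : j = k <;> simp [hjk]

/-- Subtracting the off-diagonal part keeps only the terms `a ⊗ gʲ` with `j` the right degree of
`a`, and these are values of `embed`. -/
theorem sub_offDiagonalMid_mem (x : Transmutation π ⊗[ℂ] CZ2) :
    x - offDiagonalMid π (bosComulMid (coact π) (proj π : Transmutation π →ₗ[ℂ] CZ2) x) ∈
      LinearMap.range (embed π) := by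
  let Q := offDiagonalMid π ∘ₗ bosComulMid (coact π) (proj π : Transmutation π →ₗ[ℂ] CZ2)
  have : (LinearMap.range (embed π)).mkQ ∘ₗ (LinearMap.id - Q) = 0 := by
    refine TensorProduct.ext (ext_of fun i j a ha => ext_grp fun k => ?_)
    have h := offDiagonalMid_bosComulMid ha k
    by_cases hjk : j = k
    · rw [if_pos hjk] at h
      simp only [Q, LinearMap.compr₂ₛₗ_apply, TensorProduct.mk_apply, LinearMap.comp_apply,
        LinearMap.sub_apply, LinearMap.id_apply, h, sub_zero, LinearMap.zero_apply,
        Submodule.mkQ_apply]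
      rw [Submodule.Quotient.mk_eq_zero]
      exact ⟨a, hjk ▸ embed_eq ha⟩
    · rw [if_neg hjk] at h
      simp [Q, h]
  exact (Submodule.Quotient.mk_eq_zero _).1 (LinearMap.congr_fun this x)

theorem offDiagonalMid_map {W : Type*} [AddCommGroup W] [Module ℂ W]
    (f : W →ₗ[ℂ] Transmutation π ⊗[ℂ] CZ2) {D : Submodule ℂ (CZ2 ⊗[ℂ] CZ2)}
    (hD : D ≤ LinearMap.range Coalgebra.comul) (t : W ⊗[ℂ] (D ⊗[ℂ] W)) :
    offDiagonalMid π (TensorProduct.map f (TensorProduct.map D.subtype f) t) = 0 := by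
  induction t with
  | zero => simp
  | add s t hs ht => rw [map_add, map_add, hs, ht, add_zero]
  | tmul y s =>
    induction s with
    | zero => simp
    | add s t hs ht => rw [TensorProduct.tmul_add, map_add, map_add, hs, ht, add_zero]
    | tmul d z =>
      obtain ⟨c, hc⟩ := hD d.2
      simp [offDiagonalMid, ← hc, offDiagonal_comul]

/-- The image of `embed` is an admissible subspace, since `embed` respects coproducts and `σ̃ ∘
embed = Δ ∘ π`. Conversely, on an admissible `W` the middle leg lies in `Δ(C(ℤ₂))`, so the
off-diagonal part of every element of `W` vanishes. -/
theorem range_embed : LinearMap.range (embed π) =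
    spinStatisticsReduction (coact π) (proj π : Transmutation π →ₗ[ℂ] CZ2) := by
  refine le_antisymm (le_sSup ?_) (sSup_le fun W hW x hx => ?_)
  · rintro _ ⟨_, ⟨a, rfl⟩, rfl⟩
    -- Membership in the flipped copy of `Δ(C(ℤ₂))` is cocommutativity.
    have hD : ∀ a : A, Coalgebra.comul (π a) ∈ (LinearMap.range Coalgebra.comul ⊓
        (LinearMap.range Coalgebra.comul).map (TensorProduct.comm ℂ CZ2 CZ2).toLinearMap :
          Submodule ℂ (CZ2 ⊗[ℂ] CZ2)) := fun a =>
      ⟨⟨_, rfl⟩, _, ⟨π a, rfl⟩, Coalgebra.comm_comul ℂ (π a)⟩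
    -- The witness is `embed ⊗ (Δ ∘ π) ⊗ embed` applied to the iterated coproduct of `a`.
    refine ⟨TensorProduct.map (embed π).rangeRestrict (TensorProduct.map
      ((Coalgebra.comul ∘ₗ (π : A →ₗ[ℂ] CZ2)).codRestrict _ hD) (embed π).rangeRestrict)
      (LinearMap.lTensor A Coalgebra.comul (Coalgebra.comul a)), ?_⟩
    have e₁ : LinearMap.lTensor (Transmutation π ⊗[ℂ] CZ2) (bosComul (coact π)) ∘ₗ
        TensorProduct.map (embed π) (embed π) =
        TensorProduct.map (embed π) (TensorProduct.map (embed π) (embed π)) ∘ₗ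
          LinearMap.lTensor A Coalgebra.comul := by
      refine TensorProduct.ext' fun x y => ?_
      have := LinearMap.congr_fun (bosComul_embed (π := π)) y
      simp only [LinearMap.comp_apply] at this
      simp [this]
    have h₁ := LinearMap.congr_fun e₁ (Coalgebra.comul a)
    have h₂ := LinearMap.congr_fun (bosComul_embed (π := π)) a
    simp only [LinearMap.comp_apply] at h₁ h₂ ⊢
    rw [h₂, h₁]
    generalize LinearMap.lTensor A (Coalgebra.comul (R := ℂ)) (Coalgebra.comul a) = t
    simp only [← LinearMap.comp_apply, ← TensorProduct.map_comp]
    congr 2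
    congr 1
    exact LinearMap.ext fun x => (rTensor_proj_embed x).symm
  · have h := hW (Submodule.mem_map_of_mem hx)
    obtain ⟨t, ht⟩ := h
    have h₀ : offDiagonalMid π
        (bosComulMid (coact π) (proj π : Transmutation π →ₗ[ℂ] CZ2) x) = 0 := by
      rw [bosComulMid, ← ht]
      exact offDiagonalMid_map W.subtype inf_le_left t
    have := sub_offDiagonalMid_mem x
    rwa [h₀, sub_zero] at this

end Transmutation

/-- The group extension that corresponds to `π : A ↠ C'(ℤ₂)`. -/
def transmutationExtension {A : Type u} [Ring A] [HopfAlgebra ℂ A] {RA : A →ₗ[ℂ] A →ₗ[ℂ] ℂ}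
    (hRA : IsCoquasitriangular RA) {π : A →ₐc[ℂ] CZ2}
    (hπ : IsQuantumGroupSurjection RA signR π) : CorrespondingExtension.{u} signR RA π where
  B := Transmutation π
  hopf := Transmutation.hopf π
  braided_comm := Transmutation.braided_comm hRA hπ
  σ := Transmutation.proj π
  σ_surjective := hπ.surjective
  σ_comodule := Transmutation.ext_of fun i j a ha => by
    have h : (Transmutation.hopf π).coact = Transmutation.coact π := rfl
    by_cases hij : i = j
    · simp [h, Transmutation.coact_of ha, trivialCoaction, hij, CharTwo.add_self_eq_zero, grp_zero]
    · simp [h, Transmutation.coact_of ha, trivialCoaction, Transmutation.proj_of, ha.map_left,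
        ha.counit_eq_zero hij]
  j := Transmutation.embed π
  j_injective := Transmutation.embed_injective
  j_range := Transmutation.range_embed
  j_one := (Transmutation.embed_eq (.one π)).trans rfl
  j_mul := Transmutation.embed_mul
  j_comul := Transmutation.bosComul_embed
  j_counit := LinearMap.ext fun a => by
    simp [bosCounit, Transmutation.bosProj_embed]
  j_antipode := Transmutation.embed_antipode
  j_R a b := by
    simp [bosR, Transmutation.bosProj_embed, hπ.pullback]
  σ_j := Transmutation.rTensor_proj_embed
  generate := Transmutation.bijective_bosMul_embed

/-! ## Uniqueness of the corresponding group extension -/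

theorem ext_component {V M : Type*} [AddCommGroup V] [Module ℂ V] [AddCommMonoid M] [Module ℂ M]
    {δ : V →ₗ[ℂ] CZ2 ⊗[ℂ] V} (hδ : IsCoaction δ) {f g : V →ₗ[ℂ] M}
    (h : ∀ i v, δ v = grp i ⊗ₜ v → f v = g v) : f = g := by
  ext v
  rw [← sum_component hδ v, map_sum, map_sum]
  exact Finset.sum_congr rfl fun i _ => h i _ (coact_component hδ i v)

section Base

variable {B : Type*} [Ring B] [Algebra ℂ B]

variable (B) in
/-- The map `B ⋊ H → B`, `b ⊗ h ↦ ε(h) b`. -/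
def bosBase : B ⊗[ℂ] CZ2 →ₗ[ℂ] B :=
  (TensorProduct.rid ℂ B).toLinearMap ∘ₗ LinearMap.lTensor B Coalgebra.counit

theorem bosBase_tmul_grp (b : B) (k : ZMod 2) : bosBase B (b ⊗ₜ grp k) = b := by
  simp [bosBase, counit_grp]

variable [Coalgebra ℂ B] {δ : B →ₗ[ℂ] CZ2 ⊗[ℂ] B}

/-- A comultiplicative map into `B ⋊ C'(ℤ₂)` is therefore determined by its composites with the
projections to the two factors; applied to `j`, this yields `j_eq`. -/
theorem map_bosBase_bosProj_bosComul (hδ : IsCoaction δ) :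
    TensorProduct.map (bosBase B) (bosProj CZ2 B) ∘ₗ bosComul δ = LinearMap.id := by
  refine TensorProduct.ext (LinearMap.ext fun b => ext_grp fun k => ?_)
  have e : TensorProduct.map (bosBase B) (bosProj CZ2 B) ∘ₗ bosComulAux δ k =
      (TensorProduct.mk ℂ B CZ2).flip (grp k) ∘ₗ (TensorProduct.rid ℂ B).toLinearMap ∘ₗ
        LinearMap.lTensor B Coalgebra.counit :=
    TensorProduct.ext (LinearMap.ext fun x => ext_component hδ fun i y hy => by
      simp [bosComulAux_tmul x k hy, bosBase_tmul_grp, bosProj_tmul, TensorProduct.smul_tmul'])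
  have h := LinearMap.congr_fun e (Coalgebra.comul b)
  simpa [bosComul_tmul_grp] using h

theorem map_bosBase_bosBase_bosComul (hδ : IsCoaction δ) :
    TensorProduct.map (bosBase B) (bosBase B) ∘ₗ bosComul δ = Coalgebra.comul ∘ₗ bosBase B := by
  refine TensorProduct.ext (LinearMap.ext fun b => ext_grp fun k => ?_)
  have e : TensorProduct.map (bosBase B) (bosBase B) ∘ₗ bosComulAux δ k = LinearMap.id :=
    TensorProduct.ext (LinearMap.ext fun x => ext_component hδ fun i y hy => by
      simp [bosComulAux_tmul x k hy, bosBase_tmul_grp])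
  have h := LinearMap.congr_fun e (Coalgebra.comul b)
  simpa [bosComul_tmul_grp, bosBase_tmul_grp] using h

/-- Recovers the coaction from the bosonized coproduct: projecting the first leg to `C(ℤ₂)` gives
`g^(i+k)`, and the extra factor `gᵏ` removes the shift since `2k = 0`. This lets `coact_base` read
off degrees from the comultiplicativity of `j`. -/
theorem coact_eq_bosComul (hδ : IsCoaction δ) (b : B) (k : ZMod 2) :
    TensorProduct.map (LinearMap.mulRight ℂ (grp k)) (bosBase B)
      (TensorProduct.map (bosProj CZ2 B) LinearMap.id (bosComul δ (b ⊗ₜ grp k))) = δ b := by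
  have key : ∀ i k : ZMod 2, i + k + k = i := by decide
  have e : TensorProduct.map (LinearMap.mulRight ℂ (grp k)) (bosBase B) ∘ₗ
      TensorProduct.map (bosProj CZ2 B) LinearMap.id ∘ₗ bosComulAux δ k =
      δ ∘ₗ (TensorProduct.lid ℂ B).toLinearMap ∘ₗ LinearMap.rTensor B Coalgebra.counit :=
    TensorProduct.ext (LinearMap.ext fun x => ext_component hδ fun i y hy => by
      simp [bosComulAux_tmul x k hy, bosBase_tmul_grp, bosProj_tmul, hy, grp_mul, key,
        TensorProduct.smul_tmul'])
  have h := LinearMap.congr_fun e (Coalgebra.comul b)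
  simpa [bosComul_tmul_grp] using h

end Base

namespace CorrespondingExtension

variable {A : Type*} [Ring A] [HopfAlgebra ℂ A] {RA : A →ₗ[ℂ] A →ₗ[ℂ] ℂ} {π : A →ₐc[ℂ] CZ2}
  (E : CorrespondingExtension signR RA π) {i j k l : ZMod 2} {a b : A}

/-- The coalgebra isomorphism `(id ⊗ ε) ∘ j` from `A` to `B`, as a linear map. -/
def base : A →ₗ[ℂ] E.B := bosBase E.B ∘ₗ E.j

/-- Apply `ε ⊗ id` to `σ̃(j(a)) = Δ(π(a))`, using that `σ` preserves counits. -/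
theorem bosProj_j (a : A) : bosProj CZ2 E.B (E.j a) = π a := by
  have e : bosProj CZ2 E.B = (TensorProduct.lid ℂ CZ2).toLinearMap ∘ₗ
      LinearMap.rTensor CZ2 Coalgebra.counit ∘ₗ LinearMap.rTensor CZ2 (E.σ : E.B →ₗ[ℂ] CZ2) := by
    rw [← LinearMap.rTensor_comp]
    have : Coalgebra.counit ∘ₗ (E.σ : E.B →ₗ[ℂ] CZ2) = Coalgebra.counit :=
      CoalgHomClass.counit_comp E.σ
    rw [this, bosProj]
  rw [e, LinearMap.comp_apply, LinearMap.comp_apply, E.σ_j]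
  simp

/-- By comultiplicativity `j(a) = base(a₁) ⊗ π(a₂)`, and the right coaction evaluates this. All
rigidity of the extension comes from this formula. -/
theorem j_eq (ha : IsHomog π i j a) : E.j a = E.base a ⊗ₜ grp j := by
  have h := LinearMap.congr_fun (map_bosBase_bosProj_bosComul E.hopf.isCoaction) (E.j a)
  have h' := LinearMap.congr_fun E.j_comul a
  have e : TensorProduct.map (bosBase E.B) (bosProj CZ2 E.B) ∘ₗ TensorProduct.map E.j E.j =
      ((TensorProduct.comm ℂ CZ2 E.B).toLinearMap ∘ₗ
        LinearMap.lTensor CZ2 E.base) ∘ₗ (TensorProduct.comm ℂ A CZ2).toLinearMap ∘ₗ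
        LinearMap.lTensor A (π : A →ₗ[ℂ] CZ2) :=
    TensorProduct.ext' fun x y => by simp [base, bosProj_j]
  have e' := LinearMap.congr_fun e (Coalgebra.comul a)
  have hr := congrArg ((TensorProduct.comm ℂ CZ2 E.B).toLinearMap ∘ₗ
        LinearMap.lTensor CZ2 E.base) ha.right
  rw [LinearMap.comp_apply] at h h' e'
  rw [h', LinearMap.comp_apply, e', LinearMap.id_apply] at h
  exact h.symm.trans (hr.trans (by simp))

theorem coact_base (ha : IsHomog π i j a) :
    E.hopf.coact (E.base a) = grp (i + j) ⊗ₜ E.base a := by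
  rw [← coact_eq_bosComul E.hopf.isCoaction (E.base a) j, ← E.j_eq ha]
  have h' := LinearMap.congr_fun E.j_comul a
  have e : TensorProduct.map (bosProj CZ2 E.B) LinearMap.id ∘ₗ TensorProduct.map E.j E.j =
      LinearMap.lTensor CZ2 E.j ∘ₗ LinearMap.rTensor A (π : A →ₗ[ℂ] CZ2) :=
    TensorProduct.ext' fun x y => by simp [bosProj_j]
  have e' := LinearMap.congr_fun e (Coalgebra.comul a)
  have hl := congrArg (LinearMap.lTensor CZ2 E.j) ha.left
  rw [LinearMap.comp_apply] at h' e'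
  rw [h', LinearMap.comp_apply, e', LinearMap.comp_apply]
  refine (congrArg _ hl).trans ?_
  simp [grp_mul, base]

theorem base_one : E.base 1 = 1 := by
  rw [base, LinearMap.comp_apply, E.j_one, ← grp_zero, bosBase_tmul_grp]

/-- Multiplicativity of `j`, read in the first tensor factor and solved for the product of `B`; the
sign is its own inverse. -/
theorem base_mul (ha : IsHomog π i j a) (hb : IsHomog π k l b) :
    E.base a * E.base b = parity (j * (k + l)) • E.base (a * b) := by
  have h := E.j_mul a b
  rw [E.j_eq ha, E.j_eq hb, E.j_eq (ha.mul hb), bosMul_tmul _ _ _ (E.coact_base hb),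
    TensorProduct.smul_tmul'] at h
  rw [tmul_grp_injective _ h, smul_smul, parity_mul_self, one_smul]

theorem comul_base (a : A) : Coalgebra.comul (R := ℂ) (E.base a) =
    TensorProduct.map E.base E.base (Coalgebra.comul a) := by
  have h := LinearMap.congr_fun (map_bosBase_bosBase_bosComul E.hopf.isCoaction) (E.j a)
  have h' := LinearMap.congr_fun E.j_comul a
  simp only [LinearMap.comp_apply] at h h'
  rw [h', ← LinearMap.comp_apply, ← TensorProduct.map_comp] at h
  exact h.symm

theorem counit_base (a : A) : Coalgebra.counit (R := ℂ) (E.base a) = Coalgebra.counit a := by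
  have e : bosCounit CZ2 E.B = Coalgebra.counit ∘ₗ bosBase E.B :=
    TensorProduct.ext (LinearMap.ext fun b => ext_grp fun k => by
      simp [bosCounit_tmul_grp, bosBase_tmul_grp])
  rw [← E.j_counit, e]
  rfl

theorem σ_base (a : A) : E.σ (E.base a) = π a := by
  have e : (E.σ : E.B →ₗ[ℂ] CZ2) ∘ₗ bosBase E.B = bosBase CZ2 ∘ₗ
      LinearMap.rTensor CZ2 (E.σ : E.B →ₗ[ℂ] CZ2) :=
    TensorProduct.ext (LinearMap.ext fun b => ext_grp fun k => by
      simp [bosBase_tmul_grp])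
  refine (LinearMap.congr_fun e (E.j a)).trans ?_
  rw [LinearMap.comp_apply, E.σ_j]
  simp [bosBase]

/-- Since `j(a)(1 ⊗ gᵏ) = base(a) ⊗ g^(j+k)`, undoing the shift turns the bijection `generate` into
`base ⊗ id`; bijectivity descends to `base` because `C(ℤ₂)` has the group-like `1`, with counit `1`.
-/
theorem base_bijective : Function.Bijective E.base := by
  have e : (bosMul signR E.hopf.coact ∘ₗ
      TensorProduct.map E.j (TensorProduct.mk ℂ E.B CZ2 1)) ∘ₗ Transmutation.rightShift π =
      LinearMap.rTensor CZ2 E.base := by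
    have key : ∀ j k : ZMod 2, j + (j + k) = k := by decide
    refine TensorProduct.ext (ext_homog (π := π) fun i j a ha => ext_grp fun k => ?_)
    have h : E.hopf.coact 1 = grp 0 ⊗ₜ 1 := E.hopf.coact_one
    simp [Transmutation.rightShift_tmul ha, E.j_eq ha, bosMul_tmul _ _ _ h, parity_zero, key]
  have h : Function.Bijective (LinearMap.rTensor CZ2 E.base) := by
    rw [← e]
    exact E.generate.comp (Transmutation.rightShift_involutive π).bijective
  constructor
  · intro a b hab
    refine tmul_grp_injective 0 (h.1 ?_)
    simp [hab]
  · intro b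
    obtain ⟨t, ht⟩ := h.2 (b ⊗ₜ grp 0)
    have e' : E.base ∘ₗ bosBase A = bosBase E.B ∘ₗ LinearMap.rTensor CZ2 E.base :=
      TensorProduct.ext (LinearMap.ext fun b => ext_grp fun k => by simp [bosBase_tmul_grp])
    refine ⟨bosBase A t, (LinearMap.congr_fun e' t).trans ?_⟩
    rw [LinearMap.comp_apply, ht, bosBase_tmul_grp]

/-- The coalgebra isomorphism `(id ⊗ ε) ∘ j` from `A` to `B`. -/
def baseEquiv : A ≃ₗ[ℂ] E.B := LinearEquiv.ofBijective E.base E.base_bijective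

theorem ext_base {M : Type*} [AddCommMonoid M] [Module ℂ M] {f g : E.B →ₗ[ℂ] M}
    (h : ∀ i j a, IsHomog π i j a → f (E.base a) = g (E.base a)) : f = g := by
  have : f ∘ₗ E.base = g ∘ₗ E.base := ext_homog h
  exact (LinearMap.cancel_right E.base_bijective.2).1 this

/-! ### The homomorphism of group extensions induced by `φ` -/

section Map

variable {A' : Type*} [Ring A'] [HopfAlgebra ℂ A'] {RA' : A' →ₗ[ℂ] A' →ₗ[ℂ] ℂ} {φ : A' →ₐc[ℂ] A}
  (E' : CorrespondingExtension signR RA' (π.comp φ))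

/-- The linear map `B' → B` that corresponds to `φ : A' → A`. -/
def mapLinear : E'.B →ₗ[ℂ] E.B := E.base ∘ₗ (φ : A' →ₗ[ℂ] A) ∘ₗ E'.baseEquiv.symm.toLinearMap

theorem mapLinear_base (a : A') : E.mapLinear E' (E'.base a) = E.base (φ a) :=
  congrArg (fun x => E.base (φ x)) (E'.baseEquiv.symm_apply_apply a)

/-- The homomorphism `B' → B` of graded Hopf algebras that corresponds to `φ : A' → A`. -/
def map : E'.B →ₐc[ℂ] E.B where
  toLinearMap := E.mapLinear E'
  counit_comp := E'.ext_base fun i j a _ => by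
    simp [mapLinear_base, counit_base]
  map_comp_comul := E'.ext_base fun i j a _ => by
    have h := LinearMap.congr_fun (CoalgHomClass.map_comp_comul φ) a
    have e : TensorProduct.map (E.mapLinear E') (E.mapLinear E') ∘ₗ
        TensorProduct.map E'.base E'.base = TensorProduct.map E.base E.base ∘ₗ
        TensorProduct.map (φ : A' →ₗ[ℂ] A) (φ : A' →ₗ[ℂ] A) :=
      TensorProduct.ext' fun x y => by simp [mapLinear_base]
    have e' := LinearMap.congr_fun e (Coalgebra.comul a)
    simp only [LinearMap.comp_apply, comul_base, mapLinear_base] at h e' ⊢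
    rw [e', h]
    rfl
  map_one' := by
    change E.mapLinear E' 1 = 1
    rw [← base_one, mapLinear_base, map_one, base_one]
  map_mul' x y := by
    have : (LinearMap.mul ℂ E'.B).compr₂ (E.mapLinear E') =
        (LinearMap.mul ℂ E.B).compl₁₂ (E.mapLinear E') (E.mapLinear E') := by
      refine E'.ext_base fun i j a ha => E'.ext_base fun k l b hb => ?_
      simp [E'.base_mul ha hb, mapLinear_base, E.base_mul ha.map_comp hb.map_comp]
    exact LinearMap.congr_fun₂ this x y

theorem map_base (a : A') : E.map E' (E'.base a) = E.base (φ a) := E.mapLinear_base E' a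

theorem map_surjective (hφ : Function.Surjective φ) : Function.Surjective (E.map E') := by
  intro b
  obtain ⟨a, rfl⟩ := E.base_bijective.2 b
  obtain ⟨a', rfl⟩ := hφ a
  exact ⟨E'.base a', E.map_base E' a'⟩

theorem isComoduleMap_map :
    IsComoduleMap E'.hopf.coact E.hopf.coact (E.map E' : E'.B →ₗ[ℂ] E.B) :=
  E'.ext_base fun i j a ha => by
    simp [E'.coact_base ha, map_base, E.coact_base ha.map_comp]

theorem σ_map (b : E'.B) : E.σ (E.map E' b) = E'.σ b := by
  obtain ⟨a, rfl⟩ := E'.base_bijective.2 b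
  rw [map_base, σ_base, σ_base]
  rfl

theorem rTensor_map_j (a : A') :
    LinearMap.rTensor CZ2 (E.map E' : E'.B →ₗ[ℂ] E.B) (E'.j a) = E.j (φ a) := by
  refine LinearMap.congr_fun (f := LinearMap.rTensor CZ2 (E.map E' : E'.B →ₗ[ℂ] E.B) ∘ₗ E'.j)
    (g := E.j ∘ₗ (φ : A' →ₗ[ℂ] A)) (ext_homog (π := π.comp φ) fun i j a ha => ?_) a
  simp [E'.j_eq ha, map_base, E.j_eq ha.map_comp]

/-- On homogeneous `a` the condition reads `ρ(base'(a)) ⊗ gʲ = base(φ(a)) ⊗ gʲ`, and the elements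
`base'(a)` span `B'`. -/
theorem eq_map {ρ : E'.B →ₐc[ℂ] E.B}
    (hρ : ∀ a : A', LinearMap.rTensor CZ2 (ρ : E'.B →ₗ[ℂ] E.B) (E'.j a) = E.j (φ a)) :
    ρ = E.map E' := by
  refine BialgHom.coe_linearMap_injective (E'.ext_base fun i j a ha => ?_)
  have h := hρ a
  rw [E'.j_eq ha, E.j_eq ha.map_comp, LinearMap.rTensor_tmul] at h
  exact (tmul_grp_injective _ h).trans (E.map_base E' a).symm

end Map

end CorrespondingExtension

end QG

end

theorem mainTheorem2 {A : Type u} {A' : Type v}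
    [Ring A] [HopfAlgebra ℂ A] [Ring A'] [HopfAlgebra ℂ A']
    (RA : A →ₗ[ℂ] A →ₗ[ℂ] ℂ) (RA' : A' →ₗ[ℂ] A' →ₗ[ℂ] ℂ)
    (hRA : QG.IsCoquasitriangular RA) (hRA' : QG.IsCoquasitriangular RA')
    (π : A →ₐc[ℂ] QG.CZ2) (φ : A' →ₐc[ℂ] A)
    (hπ : QG.IsQuantumGroupSurjection RA QG.signR π)
    (hφ : QG.IsQuantumGroupSurjection RA' RA φ) :
    Nonempty (QG.CorrespondingExtension.{u} QG.signR RA π) ∧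
    Nonempty (QG.CorrespondingExtension.{v} QG.signR RA' (π.comp φ)) ∧
    ∀ (E : QG.CorrespondingExtension.{u} QG.signR RA π)
      (E' : QG.CorrespondingExtension.{v} QG.signR RA' (π.comp φ)),
      ∃ ρ : E'.B →ₐc[ℂ] E.B,
        Function.Surjective ρ ∧
        QG.IsComoduleMap E'.hopf.coact E.hopf.coact (ρ : E'.B →ₗ[ℂ] E.B) ∧
        (∀ b : E'.B, E.σ (ρ b) = E'.σ b) ∧
        (∀ a : A', LinearMap.rTensor QG.CZ2 (ρ : E'.B →ₗ[ℂ] E.B) (E'.j a) = E.j (φ a)) ∧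
        ∀ ρ₁ : E'.B →ₐc[ℂ] E.B,
          QG.IsComoduleMap E'.hopf.coact E.hopf.coact (ρ₁ : E'.B →ₗ[ℂ] E.B) →
          (∀ a : A', LinearMap.rTensor QG.CZ2 (ρ₁ : E'.B →ₗ[ℂ] E.B) (E'.j a) = E.j (φ a)) →
          ρ₁ = ρ := by
  -- Surjections of coquasitriangular Hopf algebras compose, so the existence construction applies
  -- to `A'` as well.
  have hπφ : QG.IsQuantumGroupSurjection RA' QG.signR (π.comp φ) :=
    ⟨hπ.surjective.comp hφ.surjective, fun a b => (hπ.pullback _ _).trans (hφ.pullback a b)⟩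
  refine ⟨⟨QG.transmutationExtension hRA hπ⟩, ⟨QG.transmutationExtension hRA' hπφ⟩, fun E E' => ?_⟩
  exact ⟨E.map E', E.map_surjective E' hφ.surjective, E.isComoduleMap_map E', E.σ_map E',
    E.rTensor_map_j E', fun ρ₁ _ h => E.eq_map E' h⟩
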